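/- Let $f:\mathbb R\to\mathbb R$ be $C^\infty$ with $f''\ge\sigma>0$ on $\mathbb R$, and let $S^1=\mathbb R/\mathbb Z$. For $\nu>0$ consider $C^\infty$ solutions $u$ on $[0,\infty)\times S^1$ of the unforced generalised Burgers equation $$u_t+f'(u)u_x-\nu u_{xx}=0,\qquad \int_{S^1}u(t,x)\,dx=0\quad(t\ge 0),$$ with initial condition $u_0=u(0,\cdot)\not\equiv 0$, and put $D=\max\big(|u_0|_{L_1}^{-1},\,|(u_0)_x|_{L_\infty}\big)$. Fix $f$, $\sigma$ and a value $D>0$. (i) There is a constant $\tilde C>0$ (depending only on $f,\sigma,D$) such that $\int_{S^1}u_x(t,x)^2\,dx\le\tilde C\nu^{-1}$ for all $t\ge0$, all $\nu\in(0,1]$ and all such solutions $u$ with this value of $D$. (ii) Let $\tilde C>0$ be any constant as in (i), set $T_1=\frac14D^{-2}\tilde C^{-1}$, $T_2=\max\big(\frac32T_1,\,2D\sigma^{-1}\big)$, and for $M\ge1$ and $k>0$ define the energy spectrum, averaged over a layer and over time, by $$E(k)=\frac1{T_2-T_1}\int_{T_1}^{T_2}\frac{\sum_{|n|\in[M^{-1}k,Mk]}|\hat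 u(t,n)|^2}{\sum_{|n|\in[M^{-1}k,Mk]}1}\,dt,\qquad \hat u(t,n)=\int_0^1u(t,x)e^{-2\pi inx}\,dx,\quad n\in\mathbb Z.$$ There is a constant $K_1>1$, depending only on $f,\sigma,D,\tilde C$, such that the following holds for every $K\ge K_1$ and all $C_1,C_2,\nu_0>0$ with $$C_1\le\tfrac14K^{-2},\qquad 5K^2\le\frac{C_1}{C_2}<\frac1{\nu_0}$$ (for instance $C_1=\frac14K^{-2}$, $C_2=\frac1{20}K^{-4}$, $\nu_0=\frac16K^{-2}$). There is $M_0\ge1$ such that for every $M\ge M_0$ there is $C>0$ with $$C^{-1}k^{-2}\le E(k)\le C\,k^{-2}$$ for all $\nu\in(0,\nu_0]$, all such solutions $u$ with the given value of $D$, and all real $k$ for which $k^{-1}$ lies in the inertial range $J_2=(C_1\nu,C_2]$. Here $M_0$ depends only on $f,\sigma,D,\tilde C,K,C_1,C_2,\nu_0$, and $C$ only on these and on $M$; in particular, neither depends on $\nu$, $u$ or $k$. -/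

import Mathlib

open scoped ContDiff

namespace Burgulence

noncomputable section

/-- A smooth solution on `[0, ∞) × S¹`, `S¹ = ℝ/ℤ`, of the unforced generalised viscous Burgers
equation `u_t + f'(u) u_x - ν u_xx = 0` with zero space average. Functions on `S¹` are
represented by `1`-periodic functions on `ℝ`; the time variable comes first. Smoothness holds up
to `t = 0`, so that the equation for `t > 0` extends to `t = 0` by continuity. -/
structure IsSolution (f : ℝ → ℝ) (ν : ℝ) (u : ℝ → ℝ → ℝ) : Prop where
  smooth : ContDiffOn ℝ ∞ (fun p : ℝ × ℝ => u p.1 p.2) (Set.Ici 0 ×ˢ Set.univ)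
  periodic : ∀ t, 0 ≤ t → Function.Periodic (u t) 1
  zero_mean : ∀ t, 0 ≤ t → ∫ x in (0 : ℝ)..1, u t x = 0
  equation : ∀ t, 0 < t → ∀ x,
    deriv (fun s => u s x) t + deriv f (u t x) * deriv (u t) x
      - ν * deriv (deriv (u t)) x = 0

/-- The norm `|v|₁` of a function on the circle. -/
def normL1 (v : ℝ → ℝ) : ℝ := ∫ x in (0 : ℝ)..1, |v x|

/-- The homogeneous norm `|v|_{1,∞} = max |v'|` of a smooth function on the circle. -/
def normW1inf (v : ℝ → ℝ) : ℝ := ⨆ x : ℝ, |deriv v x|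

/-- The squared homogeneous norm `‖v‖₁² = |v'|₂²` of a smooth function on the circle. -/
def sqNormH1 (v : ℝ → ℝ) : ℝ := ∫ x in (0 : ℝ)..1, (deriv v x) ^ 2

/-- The parameter `D = max (|u₀|₁⁻¹, |u₀|_{1,∞})` of an initial condition. It is positive exactly
when the smooth zero mean function `u₀` is not identically zero. -/
def genericity (u₀ : ℝ → ℝ) : ℝ := max (normL1 u₀)⁻¹ (normW1inf u₀)

/-- `Ct` is a constant for which the bound `‖u(t)‖₁² ≤ Ct ν⁻¹` holds for all times, all
viscosities `ν ∈ (0, 1]` and all solutions whose initial condition has the parameter `D`. -/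
def IsH1Bound (f : ℝ → ℝ) (D Ct : ℝ) : Prop :=
  ∀ ν : ℝ, 0 < ν → ν ≤ 1 → ∀ u : ℝ → ℝ → ℝ, IsSolution f ν u → genericity (u 0) = D →
    ∀ t, 0 ≤ t → sqNormH1 (u t) ≤ Ct * ν⁻¹

/-- Beginning of the averaging interval, `T₁ = D⁻² Ct⁻¹ / 4`. -/
def T₁ (D Ct : ℝ) : ℝ := 1 / 4 * (D ^ 2)⁻¹ * Ct⁻¹

/-- End of the averaging interval, `T₂ = max (3 T₁ / 2, 2 D σ⁻¹)`. -/
def T₂ (σ D Ct : ℝ) : ℝ := max (3 / 2 * T₁ D Ct) (2 * D * σ⁻¹)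

/-- The time average `{A}` of `A` over `[a, b]`. -/
def timeAverage (a b : ℝ) (A : ℝ → ℝ) : ℝ := (b - a)⁻¹ * ∫ t in a..b, A t

/-- The layer of all integers `n` with `|n| ∈ [M⁻¹ k, M k]`. -/
def layer (M k : ℝ) : Finset ℤ :=
  open Classical in
  (Finset.Icc (-⌊M * k⌋) ⌊M * k⌋).filter fun n => |(n : ℝ)| ∈ Set.Icc (M⁻¹ * k) (M * k)

theorem mem_layer {M k : ℝ} {n : ℤ} :
    n ∈ layer M k ↔ |(n : ℝ)| ∈ Set.Icc (M⁻¹ * k) (M * k) := by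
  simp only [layer, Finset.mem_filter, Finset.mem_Icc, and_iff_right_iff_imp]
  intro h
  have h1 := abs_le.mp h.2
  refine ⟨?_, Int.le_floor.mpr h1.2⟩
  have h2 : -n ≤ ⌊M * k⌋ := by
    rw [Int.le_floor]
    push_cast
    linarith [h1.1]
  omega

/-- The `n`-th complex Fourier coefficient `∫₀¹ v(x) exp(-2πinx) dx`. -/
def fourierCoefficient (v : ℝ → ℝ) (n : ℤ) : ℂ :=
  fourierCoeffOn (zero_lt_one (α := ℝ)) (fun x => (v x : ℂ)) n

/-- The energy spectrum: the average of `|û(t, n)|²` over the layer `|n| ∈ [M⁻¹ k, M k]`,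
averaged over the time interval `[a, b]`. -/
def energySpectrum (a b M : ℝ) (u : ℝ → ℝ → ℝ) (k : ℝ) : ℝ :=
  timeAverage a b fun t =>
    (∑ n ∈ layer M k, ‖fourierCoefficient (u t) n‖ ^ 2) / (∑ _n ∈ layer M k, (1 : ℝ))

/-- The inertial range `J₂ = (C₁ ν, C₂]`. -/
def inertialRange (C₁ C₂ ν : ℝ) : Set ℝ := Set.Ioc (C₁ * ν) C₂

/-- The conditions on `C₁, C₂, ν₀` relative to `K` under which `(0, C₁ν]`, `(C₁ν, C₂]`, `(C₂, 1]`
are used as the dissipation, inertial and energy ranges for `0 < ν ≤ ν₀`. They imply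
`C₁ ν₀ < C₂ < 1`, and `C₁ = K⁻²/4`, `C₂ = K⁻⁴/20`, `ν₀ = K⁻²/6` satisfy them. -/
structure AdmissibleRanges (K C₁ C₂ ν₀ : ℝ) : Prop where
  C₁_pos : 0 < C₁
  C₂_pos : 0 < C₂
  ν₀_pos : 0 < ν₀
  C₁_le : C₁ ≤ 1 / 4 * (K ^ 2)⁻¹
  le_ratio : 5 * K ^ 2 ≤ C₁ / C₂
  ratio_lt : C₁ / C₂ < 1 / ν₀

end

end Burgulence

namespace Burgulence

open MeasureTheory Set Filter Topology intervalIntegral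

/-! ### The maximum principle -/

/-! Write v = u_x. Everything rests on the one-sided bound v ≤ D, propagated from t = 0 by the
maximum principle. For a periodic function of zero mean it gives |u| ≤ D, ∫|v| ≤ 2D and |û(n)| ≤
D/|n|; the last estimate is already the upper bound for E(k). The flux νv - f(u) obeys a minimum
principle, so |v| is of order 1/ν, and with ∫|v| ≤ 2D this gives (i).

The lower bound comes from the balance of the autocorrelation R(t,l) = ∫u(x)u(x+l)dx, in the manner
of Kármán and Howarth. Its time derivative is the l-derivative of G(t,l) = ∫[f(u)u⁺ - u f(u⁺) +
2νuv⁺]dx, where ⁺ denotes the shift by l, and G(t,0) = 0. By (i) and the Oleinik estimate σtv ≤ 1,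
R(·,0) drops by at least ε = D⁻²/4 between T₁ and T₂ (`energy_drop`). Since R(t,0) - R(t,l) is half
the structure function S(t,l) = ∫(u⁺-u)²dx, which lies between 0 and 4D²l, the time integral of G is
at most -(ε/2)l for small l.

Conversely, the inviscid part of G is the integrated error of a trapezoidal rule for f between u and
u⁺, hence at least -2ΛS with Λ a Lipschitz constant of f, and the viscous part is -ν∂S/∂l
(`flux_lower_bound`). So φ(l) = ∫S dt satisfies 2Λφ + νφ' ≥ (ε/2)l. Integrating this inequality over
an l-interval of length proportional to ν removes the viscous term and gives φ(l) ≥ cl for l ≥ C₁ν,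
with c independent of ν (`le_integral_structureFunction`).

Finally, Parseval expresses S(t,1/k) through |û(n)|². The decay of û makes the modes outside the
layer contribute O(1/(kM)), so for large M the layer carries a fixed share of c/k; it has at most
3Mk modes, whence the order k⁻². -/

/-- If the second derivative were positive, the critical point would also be a local minimum, so g
would be locally constant and the second derivative zero. -/
theorem second_derivative_nonpos_of_forall_le {g g' : ℝ → ℝ} {g'' x : ℝ}
    (h1 : ∀ y, HasDerivAt g (g' y) y) (h2 : HasDerivAt g' g'' x) (hmax : ∀ y, g y ≤ g x) :
    g' x = 0 ∧ g'' ≤ 0 := by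
  have hloc : IsLocalMax g x := Eventually.of_forall hmax
  have h0 : g' x = 0 := hloc.hasDerivAt_eq_zero (h1 x)
  refine ⟨h0, ?_⟩
  by_contra! hpos
  have hd : deriv g = g' := funext fun y => (h1 y).deriv
  have hmin : IsLocalMin g x := by
    refine isLocalMin_of_deriv_deriv_pos ?_ ?_ (h1 x).continuousAt
    · rwa [hd, h2.deriv]
    · rw [hd, h0]
  have hconst : g =ᶠ[𝓝 x] fun _ => g x := by
    filter_upwards [hmin] with y hy using le_antisymm (hmax y) hy
  have hd0 : g' =ᶠ[𝓝 x] fun _ => 0 := by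
    have := hconst.deriv
    rw [hd] at this
    simpa using this
  have : g'' = 0 := h2.unique ((hasDerivAt_const x (0 : ℝ)).congr_of_eventuallyEq hd0)
  exact hpos.ne' this

theorem deriv_nonneg_of_forall_le_left {g : ℝ → ℝ} {g' a t : ℝ} (hat : a < t)
    (h : HasDerivAt g g' t) (hle : ∀ s ∈ Ioo a t, g s ≤ g t) : 0 ≤ g' := by
  have h1 : Tendsto (slope g t) (𝓝[<] t) (𝓝 g') :=
    (hasDerivAt_iff_tendsto_slope.mp h).mono_left
      (nhdsWithin_mono _ fun s hs => (ne_of_lt hs : s ≠ t))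
  refine ge_of_tendsto h1 ?_
  filter_upwards [Ioo_mem_nhdsLT hat] with s hs
  rw [slope_def_field]
  exact div_nonneg_of_nonpos (by linarith [hle s hs]) (by linarith [hs.2])

/-- Each equation enters only through `hmax`, a sign condition at positive spatial maxima. The
restriction to positive values is what the quadratic term in the Oleinik estimate needs. -/
theorem nonpos_of_maximum_principle {z zt : ℝ → ℝ → ℝ}
    (hc : Continuous fun p : ℝ × ℝ => z p.1 p.2)
    (hper : ∀ t, Function.Periodic (z t) 1) (h0 : ∀ x, z 0 x ≤ 0)
    (ht : ∀ t, 0 < t → ∀ x, HasDerivAt (fun s => z s x) (zt t x) t)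
    (hmax : ∀ t, 0 < t → ∀ x, (∀ y, z t y ≤ z t x) → 0 < z t x → zt t x ≤ 0)
    {t : ℝ} (htn : 0 ≤ t) (x : ℝ) : z t x ≤ 0 := by
  by_contra! hpos
  have htpos : 0 < t := by
    rcases htn.eq_or_lt with rfl | h
    · exact absurd (h0 x) (not_le.mpr hpos)
    · exact h
  -- Subtracting ε s costs at most half of z t x on [0, t], so the maximum of the penalised function
  -- stays positive and is attained at a positive time, where the time derivative of z is at least
  -- ε.
  set ε := z t x / (2 * t) with hε
  have hεpos : 0 < ε := by positivity
  have hεt : ε * t = z t x / 2 := by rw [hε]; field_simp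
  obtain ⟨⟨s, y⟩, ⟨hs, hy⟩, hsy⟩ := (isCompact_Icc.prod isCompact_Icc :
      IsCompact (Icc (0 : ℝ) t ×ˢ Icc (0 : ℝ) 1)).exists_isMaxOn
    (f := fun p : ℝ × ℝ => z p.1 p.2 - ε * p.1)
    ⟨(0, 0), ⟨le_rfl, htn⟩, ⟨le_rfl, zero_le_one⟩⟩
    (by fun_prop)
  have hfract : ∀ r b, z r b = z r (Int.fract b) := fun r b => by
    have := (hper r).sub_int_mul_eq (x := b) ⌊b⌋
    rw [mul_one] at this
    exact this.symm
  have key : ∀ r ∈ Icc 0 t, ∀ b, z r b - ε * r ≤ z s y - ε * s := fun r hr b => by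
    rw [hfract r b]
    exact hsy (a := (r, Int.fract b)) ⟨hr, ⟨Int.fract_nonneg b, (Int.fract_lt_one b).le⟩⟩
  have hbig : z t x / 2 ≤ z s y - ε * s := by
    have := key t ⟨htn, le_rfl⟩ x
    linarith
  have hzpos : 0 < z s y := by
    have : 0 ≤ ε * s := mul_nonneg hεpos.le hs.1
    linarith
  have hspos : 0 < s := by
    rcases hs.1.eq_or_lt with h | h
    · replace h : 0 = s := h
      rw [← h] at hzpos
      exact absurd (h0 y) (not_le.mpr hzpos)
    · exact h
  have hle := hmax s hspos y (fun b => by linarith [key s hs b]) hzpos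
  have hd : HasDerivAt (fun r => z r y - ε * r) (zt s y - ε * 1) s :=
    (ht s hspos y).sub ((hasDerivAt_id s).const_mul ε)
  have := deriv_nonneg_of_forall_le_left hspos hd
    fun r hr => key r ⟨hr.1.le, hr.2.le.trans hs.2⟩ y
  linarith

/-! ### Parametric integrals -/

theorem continuous_intervalIntegral {X E : Type*} [TopologicalSpace X]
    [NormedAddCommGroup E] [NormedSpace ℝ E] {F : X → ℝ → E}
    (hF : Continuous fun p : X × ℝ => F p.1 p.2) (a b : ℝ) :
    Continuous fun s => ∫ x in a..b, F s x :=
  continuous_parametric_intervalIntegral_of_continuous' hF a b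

theorem integral_swap_of_continuous {F : ℝ → ℝ → ℝ}
    (hF : Continuous fun p : ℝ × ℝ => F p.1 p.2) (a b c d : ℝ) :
    ∫ s in a..b, ∫ x in c..d, F s x = ∫ x in c..d, ∫ s in a..b, F s x := by
  refine intervalIntegral_intervalIntegral_swap ?_
  exact (hF.continuousOn.integrableOn_compact
    (isCompact_uIcc.prod isCompact_uIcc)).mono_set
      (prod_mono uIoc_subset_uIcc uIoc_subset_uIcc)

/-- Fundamental theorem in time plus Fubini. Differentiability is only needed in the open interval,
so the left end may be t = 0. -/
theorem integral_sub_integral_of_hasDerivAt {p q : ℝ → ℝ → ℝ}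
    (hp : Continuous fun r : ℝ × ℝ => p r.1 r.2) (hq : Continuous fun r : ℝ × ℝ => q r.1 r.2)
    {a b : ℝ} (hab : a ≤ b) (h : ∀ t ∈ Ioo a b, ∀ x, HasDerivAt (fun s => p s x) (q t x) t)
    (c d : ℝ) :
    (∫ x in c..d, p b x) - ∫ x in c..d, p a x = ∫ t in a..b, ∫ x in c..d, q t x := by
  rw [integral_swap_of_continuous hq, ← intervalIntegral.integral_sub]
  · refine intervalIntegral.integral_congr fun x _ => ?_
    refine (integral_eq_sub_of_hasDerivAt_of_le hab ?_ (fun t ht => h t ht x) ?_).symm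
    · exact (hp.comp (by fun_prop : Continuous fun s : ℝ => (s, x))).continuousOn
    · exact (hq.comp (by fun_prop : Continuous fun s : ℝ => (s, x))).intervalIntegrable _ _
  · exact (hp.comp (by fun_prop : Continuous fun x : ℝ => (b, x))).intervalIntegrable _ _
  · exact (hp.comp (by fun_prop : Continuous fun x : ℝ => (a, x))).intervalIntegrable _ _

theorem hasDerivAt_intervalIntegral {p q : ℝ → ℝ → ℝ}
    (hp : Continuous fun r : ℝ × ℝ => p r.1 r.2) (hq : Continuous fun r : ℝ × ℝ => q r.1 r.2)
    (h : ∀ t x, HasDerivAt (fun s => p s x) (q t x) t) (c d t : ℝ) :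
    HasDerivAt (fun s => ∫ x in c..d, p s x) (∫ x in c..d, q t x) t := by
  have hJ : Continuous fun s => ∫ x in c..d, q s x := continuous_intervalIntegral hq c d
  have h1 : ∀ s, t - 1 ≤ s → ∫ x in c..d, p s x =
      (∫ x in c..d, p (t - 1) x) + ∫ r in (t - 1)..s, ∫ x in c..d, q r x := fun s hs => by
    rw [← integral_sub_integral_of_hasDerivAt hp hq hs (fun r _ x => h r x)]
    ring
  have h2 : HasDerivAt (fun s => (∫ x in c..d, p (t - 1) x) +
      ∫ r in (t - 1)..s, ∫ x in c..d, q r x) (∫ x in c..d, q t x) t :=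
    (integral_hasDerivAt_right (hJ.intervalIntegrable _ _)
      (hJ.stronglyMeasurableAtFilter _ _) hJ.continuousAt).const_add _
  refine h2.congr_of_eventuallyEq ?_
  filter_upwards [Ici_mem_nhds (by linarith : t - 1 < t)] with s hs using h1 s hs

/-! ### Periodic functions -/

theorem integral_comp_add_of_periodic {E : Type*} [NormedAddCommGroup E] [NormedSpace ℝ E]
    {g : ℝ → E} (hg : Function.Periodic g 1) (l : ℝ) :
    ∫ x in (0 : ℝ)..1, g (x + l) = ∫ x in (0 : ℝ)..1, g x := by
  rw [intervalIntegral.integral_comp_add_right]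
  have := hg.intervalIntegral_add_eq (0 + l) 0
  rw [show 1 + l = 0 + l + 1 by ring, this, zero_add]

theorem integral_eq_zero_of_periodic {g g' : ℝ → ℝ} (hg : Function.Periodic g 1)
    (h : ∀ x, HasDerivAt g (g' x) x) (hc : Continuous g') :
    ∫ x in (0 : ℝ)..1, g' x = 0 := by
  rw [integral_eq_sub_of_hasDerivAt (fun x _ => h x) (hc.intervalIntegrable _ _)]
  have := hg 0
  rw [zero_add] at this
  linarith

/-! ### Regularity of solutions -/

/-- The closed half-plane `[0, ∞) × ℝ`. -/
def halfPlane : Set (ℝ × ℝ) := Ici 0 ×ˢ univ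

/-- The derivative of a function on the closed half-plane in the direction of the second
variable. -/
noncomputable def spaceDeriv (g : ℝ × ℝ → ℝ) (p : ℝ × ℝ) : ℝ :=
  fderivWithin ℝ g halfPlane p (0, 1)

theorem uniqueDiffOn_halfPlane : UniqueDiffOn ℝ halfPlane :=
  (uniqueDiffOn_Ici 0).prod uniqueDiffOn_univ

theorem contDiffOn_spaceDeriv {g : ℝ × ℝ → ℝ} (hg : ContDiffOn ℝ ∞ g halfPlane) :
    ContDiffOn ℝ ∞ (spaceDeriv g) halfPlane :=
  (hg.fderivWithin uniqueDiffOn_halfPlane (by simp)).clm_apply contDiffOn_const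

theorem hasDerivAt_spaceDeriv {g : ℝ × ℝ → ℝ} (hg : ContDiffOn ℝ ∞ g halfPlane) {t : ℝ}
    (ht : 0 ≤ t) (x : ℝ) : HasDerivAt (fun y => g (t, y)) (spaceDeriv g (t, x)) x := by
  have h1 : HasFDerivWithinAt g (fderivWithin ℝ g halfPlane (t, x)) halfPlane (t, x) :=
    ((hg.differentiableOn (by simp)) (t, x) ⟨ht, mem_univ x⟩).hasFDerivWithinAt
  have h2 : HasDerivAt (fun y : ℝ => (t, y)) ((0 : ℝ), (1 : ℝ)) x :=
    (hasDerivAt_const x t).prodMk (hasDerivAt_id x)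
  have h3 := h1.comp_hasDerivWithinAt (s := univ) x h2.hasDerivWithinAt
    (fun y _ => ⟨ht, mem_univ y⟩)
  exact h3.hasDerivAt univ_mem

theorem halfPlane_mem_nhds {t : ℝ} (ht : 0 < t) (x : ℝ) : halfPlane ∈ 𝓝 (t, x) :=
  prod_mem_nhds (Ici_mem_nhds ht) univ_mem

theorem hasDerivAt_time {g : ℝ × ℝ → ℝ} (hg : ContDiffOn ℝ ∞ g halfPlane) {t : ℝ}
    (ht : 0 < t) (x : ℝ) : HasDerivAt (fun s => g (s, x)) (fderiv ℝ g (t, x) (1, 0)) t := by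
  have h1 : HasFDerivAt g (fderiv ℝ g (t, x)) (t, x) :=
    ((hg.contDiffAt (halfPlane_mem_nhds ht x)).differentiableAt (by simp)).hasFDerivAt
  have h2 : HasDerivAt (fun s : ℝ => (s, x)) ((1 : ℝ), (0 : ℝ)) t :=
    (hasDerivAt_id t).prodMk (hasDerivAt_const t x)
  exact h1.comp_hasDerivAt t h2

theorem continuous_freeze {g : ℝ × ℝ → ℝ} (hg : ContinuousOn g halfPlane) :
    Continuous fun p : ℝ × ℝ => g (max p.1 0, p.2) :=
  hg.comp_continuous (by fun_prop) fun p => ⟨le_max_right p.1 0, mem_univ p.2⟩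

/-- The time derivative and the space derivative of a smooth function commute. -/
theorem fderiv_spaceDeriv {g : ℝ × ℝ → ℝ} (hg : ContDiffOn ℝ ∞ g halfPlane) {t : ℝ}
    (ht : 0 < t) {x e' : ℝ}
    (he : HasDerivAt (fun y => fderiv ℝ g (t, y) (1, 0)) e' x) :
    fderiv ℝ (spaceDeriv g) (t, x) (1, 0) = e' := by
  have hca : ContDiffAt ℝ ∞ g (t, x) := hg.contDiffAt (halfPlane_mem_nhds ht x)
  have hfd : DifferentiableAt ℝ (fderiv ℝ g) (t, x) :=
    (hca.fderiv_right (m := ∞) (by simp)).differentiableAt (by simp)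
  have hev : spaceDeriv g =ᶠ[𝓝 (t, x)] fun p => fderiv ℝ g p (0, 1) := by
    have : ∀ᶠ p : ℝ × ℝ in 𝓝 (t, x), 0 < p.1 :=
      continuous_fst.continuousAt.eventually (lt_mem_nhds ht)
    filter_upwards [this] with p hp
    rw [spaceDeriv, fderivWithin_of_mem_nhds (halfPlane_mem_nhds hp p.2)]
  have h1 : fderiv ℝ (spaceDeriv g) (t, x) (1, 0) =
      fderiv ℝ (fderiv ℝ g) (t, x) (1, 0) (0, 1) := by
    rw [hev.fderiv_eq]
    have := hfd.hasFDerivAt.clm_apply (hasFDerivAt_const ((0 : ℝ), (1 : ℝ)) (t, x))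
    rw [this.fderiv]
    simp
  have h2 : HasDerivAt (fun y => fderiv ℝ g (t, y) (1, 0))
      (fderiv ℝ (fderiv ℝ g) (t, x) (0, 1) (1, 0)) x := by
    have ha := hfd.hasFDerivAt.clm_apply (hasFDerivAt_const ((1 : ℝ), (0 : ℝ)) (t, x))
    have hb : HasDerivAt (fun y : ℝ => (t, y)) ((0 : ℝ), (1 : ℝ)) x :=
      (hasDerivAt_const x t).prodMk (hasDerivAt_id x)
    have := HasFDerivAt.comp_hasDerivAt x ha hb
    refine (this.congr_deriv ?_ : HasDerivAt (fun y => fderiv ℝ g (t, y) (1, 0)) _ x)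
    simp
  have hsymm : IsSymmSndFDerivAt ℝ g (t, x) := hca.isSymmSndFDerivAt (by
    rw [minSmoothness_of_isRCLikeNormedField]
    exact WithTop.coe_le_coe.mpr le_top)
  rw [h1, hsymm.eq, h2.unique he]

/-- A solution of the Burgers equation together with its first three space derivatives
`v = u_x`, `w = u_xx`, `z = u_xxx`, all of them continuous on the whole plane. -/
structure IsFlow (f : ℝ → ℝ) (ν : ℝ) (u v w z : ℝ → ℝ → ℝ) : Prop where
  continuous_u : Continuous fun p : ℝ × ℝ => u p.1 p.2
  continuous_v : Continuous fun p : ℝ × ℝ => v p.1 p.2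
  continuous_w : Continuous fun p : ℝ × ℝ => w p.1 p.2
  hasDerivAt_u : ∀ t x, HasDerivAt (u t) (v t x) x
  hasDerivAt_v : ∀ t x, HasDerivAt (v t) (w t x) x
  hasDerivAt_w : ∀ t x, HasDerivAt (w t) (z t x) x
  periodic : ∀ t, Function.Periodic (u t) 1
  zero_mean : ∀ t, ∫ x in (0 : ℝ)..1, u t x = 0
  time_u : ∀ t, 0 < t → ∀ x,
    HasDerivAt (fun s => u s x) (-(deriv f (u t x) * v t x) + ν * w t x) t
  time_v : ∀ t, 0 < t → ∀ x,
    HasDerivAt (fun s => v s x)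
      (-(deriv (deriv f) (u t x) * v t x ^ 2 + deriv f (u t x) * w t x) + ν * z t x) t

theorem hasDerivAt_deriv_of_contDiff {f : ℝ → ℝ} (hf : ContDiff ℝ ∞ f) (x : ℝ) :
    HasDerivAt (deriv f) (deriv (deriv f) x) x := by
  have h : ContDiff ℝ ∞ (deriv f) := (contDiff_infty_iff_deriv.mp hf).2
  exact (h.differentiable (by simp) x).hasDerivAt

/-- Freezing u at its initial value for negative times makes u and its space derivatives continuous
on the whole plane, so later integrals need no care at the boundary. -/
theorem IsSolution.exists_isFlow {f : ℝ → ℝ} (hf : ContDiff ℝ ∞ f) {ν : ℝ} {u : ℝ → ℝ → ℝ}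
    (hu : IsSolution f ν u) :
    ∃ v w z, IsFlow f ν (fun t => u (max t 0)) v w z := by
  set g : ℝ × ℝ → ℝ := fun p => u p.1 p.2 with hgdef
  have hg : ContDiffOn ℝ ∞ g halfPlane := hu.smooth
  have hv := contDiffOn_spaceDeriv hg
  have hw := contDiffOn_spaceDeriv hv
  have hderiv : ∀ t, 0 ≤ t → deriv (u t) = fun x => spaceDeriv g (t, x) := fun t ht =>
    funext fun x => (hasDerivAt_spaceDeriv hg ht x).deriv
  have hderiv2 : ∀ t, 0 ≤ t → deriv (deriv (u t)) = fun x => spaceDeriv (spaceDeriv g) (t, x) :=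
    fun t ht => funext fun x => by
      rw [hderiv t ht]
      exact (hasDerivAt_spaceDeriv hv ht x).deriv
  have heq : ∀ t, 0 < t → ∀ x, fderiv ℝ g (t, x) (1, 0) =
      -(deriv f (u t x) * spaceDeriv g (t, x)) + ν * spaceDeriv (spaceDeriv g) (t, x) :=
    fun t ht x => by
      have h := hu.equation t ht x
      rw [hderiv2 t ht.le, hderiv t ht.le] at h
      have : deriv (fun s => u s x) t = fderiv ℝ g (t, x) (1, 0) := (hasDerivAt_time hg ht x).deriv
      rw [this] at h
      linarith
  have hfreeze : ∀ {q : ℝ × ℝ → ℝ} {q' t : ℝ} (x : ℝ), 0 < t →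
      HasDerivAt (fun s => q (s, x)) q' t → HasDerivAt (fun s => q (max s 0, x)) q' t :=
    fun {q q' t} x ht h => by
      refine h.congr_of_eventuallyEq ?_
      filter_upwards [lt_mem_nhds ht] with s hs
      rw [max_eq_left (le_of_lt hs)]
  refine ⟨fun t x => spaceDeriv g (max t 0, x), fun t x => spaceDeriv (spaceDeriv g) (max t 0, x),
    fun t x => spaceDeriv (spaceDeriv (spaceDeriv g)) (max t 0, x),
    continuous_freeze hg.continuousOn, continuous_freeze hv.continuousOn,
    continuous_freeze hw.continuousOn,
    fun t x => hasDerivAt_spaceDeriv hg (le_max_right t 0) x,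
    fun t x => hasDerivAt_spaceDeriv hv (le_max_right t 0) x,
    fun t x => hasDerivAt_spaceDeriv hw (le_max_right t 0) x,
    fun t => hu.periodic _ (le_max_right t 0), fun t => hu.zero_mean _ (le_max_right t 0),
    fun t ht x => ?_, fun t ht x => ?_⟩
  · rw [max_eq_left ht.le, ← heq t ht x]
    exact hfreeze (q := g) x ht (hasDerivAt_time hg ht x)
  · rw [max_eq_left ht.le]
    refine hfreeze (q := spaceDeriv g) x ht ?_
    -- The equation differentiated in x; as mixed derivatives commute, this is the time derivative
    -- of u_x.
    have hE : HasDerivAt (fun y => fderiv ℝ g (t, y) (1, 0))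
        (-(deriv (deriv f) (u t x) * spaceDeriv g (t, x) ^ 2 +
          deriv f (u t x) * spaceDeriv (spaceDeriv g) (t, x)) +
          ν * spaceDeriv (spaceDeriv (spaceDeriv g)) (t, x)) x := by
      have hfun : (fun y => fderiv ℝ g (t, y) (1, 0)) = fun y =>
          -(deriv f (u t y) * spaceDeriv g (t, y)) + ν * spaceDeriv (spaceDeriv g) (t, y) :=
        funext fun y => heq t ht y
      rw [hfun]
      have h0 : HasDerivAt (u t) (spaceDeriv g (t, x)) x := hasDerivAt_spaceDeriv hg ht.le x
      have h1 := hasDerivAt_spaceDeriv hv ht.le x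
      have h2 := hasDerivAt_spaceDeriv hw ht.le x
      have h3 := (hasDerivAt_deriv_of_contDiff hf (u t x)).comp x h0
      refine (((h3.mul h1).neg.add (h2.const_mul ν))).congr_deriv ?_
      simp only [Function.comp]
      ring
    rw [← fderiv_spaceDeriv hg ht hE]
    exact hasDerivAt_time hv ht x

/-! ### Periodic functions with a one-sided derivative bound -/

theorem periodic_of_hasDerivAt {g g' : ℝ → ℝ} (hg : Function.Periodic g 1)
    (h : ∀ x, HasDerivAt g (g' x) x) : Function.Periodic g' 1 := fun x => by
  have h1 : HasDerivAt (fun y => g (y + 1)) (g' (x + 1)) x := (h (x + 1)).comp_add_const x 1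
  have h2 : (fun y => g (y + 1)) = g := funext hg
  rw [h2] at h1
  exact h1.unique (h x)

theorem continuous_slice {q : ℝ → ℝ → ℝ} (hq : Continuous fun p : ℝ × ℝ => q p.1 p.2) (t : ℝ) :
    Continuous (q t) :=
  hq.comp (by fun_prop : Continuous fun x : ℝ => (t, x))

theorem sub_le_mul_of_hasDerivAt_le {g g' : ℝ → ℝ} {m : ℝ} (h : ∀ x, HasDerivAt g (g' x) x)
    (hm : ∀ x, g' x ≤ m) {x y : ℝ} (hxy : x ≤ y) : g y - g x ≤ m * (y - x) :=
  image_sub_le_mul_sub_of_deriv_le (fun x => (h x).differentiableAt)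
    (fun x => (h x).deriv.trans_le (hm x)) hxy

theorem exists_forall_abs_le_of_periodic {g : ℝ → ℝ} (hg : Function.Periodic g 1)
    (hc : Continuous g) : ∃ B, ∀ x, |g x| ≤ B := by
  obtain ⟨B, hB⟩ := isCompact_Icc.exists_bound_of_continuousOn (s := Icc (0 : ℝ) 1) hc.continuousOn
  refine ⟨B, fun x => ?_⟩
  obtain ⟨y, hy, hxy⟩ := hg.exists_mem_Ico₀ one_pos x
  rw [hxy]
  exact hB y ⟨hy.1, hy.2.le⟩

/-- A periodic function of zero mean whose derivative is at most `m` is bounded by `m`. -/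
theorem abs_le_of_hasDerivAt_le {g g' : ℝ → ℝ} {m : ℝ} (hg : Function.Periodic g 1)
    (h : ∀ x, HasDerivAt g (g' x) x) (h0 : ∫ x in (0 : ℝ)..1, g x = 0) (hm0 : 0 ≤ m)
    (hm : ∀ x, g' x ≤ m) (x : ℝ) : |g x| ≤ m := by
  have hc : Continuous g := continuous_iff_continuousAt.mpr fun x => (h x).continuousAt
  have hint : ∀ a, ∫ y in a..a + 1, g y = 0 := fun a => by
    rw [hg.intervalIntegral_add_eq a 0, zero_add, h0]
  rw [abs_le]
  constructor
  -- On the period to the right of x, g is at most g x + m, and its mean vanishes there; the period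
  -- to the left gives the other inequality.
  · have h1 : ∫ y in x..x + 1, g y ≤ ∫ y in x..x + 1, (g x + m) := by
      refine integral_mono_on (by linarith) (hc.intervalIntegrable _ _)
        (intervalIntegrable_const) fun y hy => ?_
      have := sub_le_mul_of_hasDerivAt_le h hm hy.1
      nlinarith [hy.2]
    rw [hint, intervalIntegral.integral_const] at h1
    simp only [add_sub_cancel_left, smul_eq_mul, one_mul] at h1
    linarith
  · have h1 : ∫ y in (x - 1)..(x - 1) + 1, (g x - m) ≤ ∫ y in (x - 1)..(x - 1) + 1, g y := by
      refine integral_mono_on (by linarith) (intervalIntegrable_const)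
        (hc.intervalIntegrable _ _) fun y hy => ?_
      have := sub_le_mul_of_hasDerivAt_le h hm (show y ≤ x by linarith [hy.2])
      nlinarith [hy.1]
    rw [hint, intervalIntegral.integral_const] at h1
    simp only [add_sub_cancel_left, smul_eq_mul, one_mul] at h1
    linarith

/-- Pointwise |g'| ≤ 2m - g', and g' has mean zero: an upper bound alone controls the total
variation. -/
theorem integral_abs_deriv_le {g g' : ℝ → ℝ} {m : ℝ} (hg : Function.Periodic g 1)
    (h : ∀ x, HasDerivAt g (g' x) x) (hc : Continuous g') (hm0 : 0 ≤ m)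
    (hm : ∀ x, g' x ≤ m) : ∫ x in (0 : ℝ)..1, |g' x| ≤ 2 * m := by
  have h1 : ∫ x in (0 : ℝ)..1, |g' x| ≤ ∫ x in (0 : ℝ)..1, (2 * m - g' x) := by
    refine integral_mono_on zero_le_one (hc.abs.intervalIntegrable _ _)
      ((continuous_const.sub hc).intervalIntegrable _ _) fun x _ => ?_
    rw [abs_le]
    constructor <;> linarith [hm x]
  rw [intervalIntegral.integral_sub (intervalIntegrable_const) (hc.intervalIntegrable _ _),
    integral_eq_zero_of_periodic hg h hc] at h1
  simpa using h1

/-! ### A priori estimates from the maximum principle -/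

namespace IsFlow

variable {f : ℝ → ℝ} {ν : ℝ} {u v w z : ℝ → ℝ → ℝ}

theorem periodic_v (H : IsFlow f ν u v w z) (t : ℝ) : Function.Periodic (v t) 1 :=
  periodic_of_hasDerivAt (H.periodic t) (H.hasDerivAt_u t)

/-- The derivative of a solution does not exceed the maximum of the initial derivative. -/
theorem v_le (H : IsFlow f ν u v w z) (hν : 0 ≤ ν) (hconv : ∀ x, 0 ≤ deriv (deriv f) x)
    {m : ℝ} (h0 : ∀ x, v 0 x ≤ m) {t : ℝ} (ht : 0 ≤ t) (x : ℝ) : v t x ≤ m := by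
  have := nonpos_of_maximum_principle (z := fun t x => v t x - m) (H.continuous_v.sub continuous_const)
    (fun t x => by simp only [H.periodic_v t x]) (fun x => by linarith [h0 x])
    (fun t ht x => (H.time_v t ht x).sub_const m)
    (fun t _ x hle _ => by
      obtain ⟨h1, h2⟩ := second_derivative_nonpos_of_forall_le (H.hasDerivAt_v t)
        (H.hasDerivAt_w t x) (fun y => by linarith [hle y])
      rw [h1]
      have h3 := mul_nonneg (hconv (u t x)) (sq_nonneg (v t x))
      have h4 := mul_nonneg hν (neg_nonneg.mpr h2)
      linarith) ht x
  linarith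

/-- The Oleinik estimate. -/
theorem mul_v_le_one (H : IsFlow f ν u v w z) (hν : 0 ≤ ν) {σ : ℝ} (hσ : 0 < σ)
    (hconv : ∀ x, σ ≤ deriv (deriv f) x) {t : ℝ} (ht : 0 ≤ t) (x : ℝ) : σ * t * v t x ≤ 1 := by
  have := nonpos_of_maximum_principle (z := fun t x => σ * t * v t x - 1)
    (by have := H.continuous_v; fun_prop)
    (fun t x => by simp only [H.periodic_v t x]) (fun x => by simp)
    (fun t ht x => ((((hasDerivAt_id t).const_mul σ).mul (H.time_v t ht x)).sub_const 1))
    (fun t ht x hle hpos => by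
      have hle' : ∀ y, v t y ≤ v t x := fun y => by
        have h5 := hle y
        have : σ * t * v t y ≤ σ * t * v t x := by linarith
        exact le_of_mul_le_mul_left this (mul_pos hσ ht)
      obtain ⟨h1, h2⟩ := second_derivative_nonpos_of_forall_le (H.hasDerivAt_v t)
        (H.hasDerivAt_w t x) hle'
      simp only [id] at hpos ⊢
      rw [h1]
      have hv : 0 < v t x := by
        by_contra! hneg
        have := mul_nonpos_of_nonneg_of_nonpos (mul_pos hσ ht).le hneg
        linarith
      have h3 := mul_nonneg hν (neg_nonneg.mpr h2)
      have h4 := mul_le_mul_of_nonneg_right (hconv (u t x)) (sq_nonneg (v t x))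
      have h6 : -(deriv (deriv f) (u t x) * v t x ^ 2 + deriv f (u t x) * 0) + ν * z t x ≤
          -(σ * v t x ^ 2) := by linarith
      have h7 := mul_le_mul_of_nonneg_left h6 (mul_pos hσ ht).le
      have h8 := mul_pos (mul_pos hσ hv) hpos
      -- With Z = σtv - 1, the time derivative at the maximum is at most σv - σ²tv² = -σvZ, which is
      -- negative where Z > 0.
      linarith) ht x
  linarith

/-- The flux `ν u_x - f(u)` satisfies a minimum principle. -/
theorem le_flux (H : IsFlow f ν u v w z) (hf : ContDiff ℝ ∞ f) (hν : 0 ≤ ν) {A : ℝ}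
    (h0 : ∀ x, A ≤ ν * v 0 x - f (u 0 x)) {t : ℝ} (ht : 0 ≤ t) (x : ℝ) :
    A ≤ ν * v t x - f (u t x) := by
  have hfd : ∀ y, HasDerivAt f (deriv f y) y := fun y =>
    (hf.differentiable (by simp) y).hasDerivAt
  have hfc : Continuous f := hf.continuous
  have := nonpos_of_maximum_principle (z := fun t x => A - (ν * v t x - f (u t x)))
    (by have := H.continuous_v; have := H.continuous_u; fun_prop)
    (fun t x => by simp only [H.periodic_v t x, H.periodic t x])
    (fun x => by linarith [h0 x])
    (fun t ht x => (((H.time_v t ht x).const_mul ν).sub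
      ((hfd (u t x)).comp t (H.time_u t ht x))).const_sub A)
    (fun t ht x hle _ => by
      -- For q = νv - f(u) one has q_x = u_t, hence q_t = νq_xx - f'(u)q_x: at a spatial minimum of
      -- q the transport term vanishes. Convexity plays no role.
      obtain ⟨h1, h2⟩ := second_derivative_nonpos_of_forall_le
        (g := fun y => A - (ν * v t y - f (u t y)))
        (g' := fun y => -(ν * w t y - deriv f (u t y) * v t y))
        (fun y => (((H.hasDerivAt_v t y).const_mul ν).sub
          ((hfd (u t y)).comp y (H.hasDerivAt_u t y))).const_sub A)
        ((((H.hasDerivAt_w t x).const_mul ν).sub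
          (((hasDerivAt_deriv_of_contDiff hf (u t x)).comp x (H.hasDerivAt_u t x)).mul
            (H.hasDerivAt_v t x))).neg) hle
      simp only [Function.comp] at h2
      have h3 : -(deriv f (u t x) * v t x) + ν * w t x = 0 := by linarith
      rw [h3]
      have h4 : 0 ≤ -(deriv (deriv f) (u t x) * v t x ^ 2 + deriv f (u t x) * w t x) +
          ν * z t x := by nlinarith
      have := mul_nonneg hν h4
      linarith) ht x
  linarith

theorem abs_u_le (H : IsFlow f ν u v w z) {t m : ℝ} (hm0 : 0 ≤ m) (hm : ∀ x, v t x ≤ m) (x : ℝ) :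
    |u t x| ≤ m :=
  abs_le_of_hasDerivAt_le (H.periodic t) (H.hasDerivAt_u t) (H.zero_mean t) hm0 hm x

theorem abs_v_zero_le (H : IsFlow f ν u v w z) (x : ℝ) : |v 0 x| ≤ genericity (u 0) := by
  have hd : deriv (u 0) = v 0 := funext fun x => (H.hasDerivAt_u 0 x).deriv
  obtain ⟨B, hB⟩ := exists_forall_abs_le_of_periodic (H.periodic_v 0)
    (continuous_slice H.continuous_v 0)
  refine le_trans ?_ (le_max_right _ _)
  rw [normW1inf, hd]
  exact le_ciSup (f := fun x => |v 0 x|) ⟨B, by rintro _ ⟨y, rfl⟩; exact hB y⟩ x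

theorem inv_genericity_le (H : IsFlow f ν u v w z) (hD : 0 < genericity (u 0)) :
    (genericity (u 0))⁻¹ ≤ normL1 (u 0) := by
  have hc := continuous_slice H.continuous_u 0
  have hnn : 0 ≤ normL1 (u 0) := integral_nonneg zero_le_one fun x _ => abs_nonneg _
  -- If the norm vanishes, its inverse is 0 by convention and u₀ ≡ 0, so the parameter would be 0.
  rcases hnn.eq_or_lt with h0 | hpos
  · exfalso
    have hz : ∀ x, u 0 x = 0 := fun x => by
      obtain ⟨y, hy, hxy⟩ := (H.periodic 0).exists_mem_Ico₀ one_pos x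
      rw [hxy]
      by_contra hne
      have : 0 < normL1 (u 0) := integral_pos zero_lt_one hc.abs.continuousOn
        (fun x _ => abs_nonneg _) ⟨y, ⟨hy.1, hy.2.le⟩, abs_pos.mpr hne⟩
      linarith
    have hfun : u 0 = fun _ => 0 := funext hz
    rw [genericity, ← h0, normW1inf, hfun] at hD
    simp at hD
  · rw [inv_le_comm₀ hD hpos]
    exact le_max_left _ _

theorem sqNormH1_eq (H : IsFlow f ν u v w z) (t : ℝ) :
    sqNormH1 (u t) = ∫ x in (0 : ℝ)..1, v t x ^ 2 := by
  have hd : deriv (u t) = v t := funext fun x => (H.hasDerivAt_u t x).deriv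
  rw [sqNormH1, hd]

end IsFlow

theorem exists_bound_on_Icc {f : ℝ → ℝ} (hf : Continuous f) (D : ℝ) :
    ∃ B, 0 ≤ B ∧ ∀ y, |y| ≤ D → |f y| ≤ B := by
  obtain ⟨B, hB⟩ := isCompact_Icc.exists_bound_of_continuousOn (s := Icc (-D) D) hf.continuousOn
  exact ⟨max B 0, le_max_right _ _, fun y hy => (hB y (abs_le.mp hy)).trans (le_max_left _ _)⟩

/-- The upper bound for the dissipation of all solutions with a given initial parameter. -/
theorem exists_isH1Bound {f : ℝ → ℝ} (hf : ContDiff ℝ ∞ f) (hconv : ∀ x, 0 ≤ deriv (deriv f) x)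
    {D : ℝ} (hD : 0 < D) : ∃ Ct : ℝ, 0 < Ct ∧ IsH1Bound f D Ct := by
  obtain ⟨B, hB0, hB⟩ := exists_bound_on_Icc hf.continuous D
  refine ⟨(2 * B + 2 * D) * (2 * D), by positivity, fun ν hν hν1 u₁ hsol hgen t ht => ?_⟩
  obtain ⟨v, w, z, H⟩ := hsol.exists_isFlow hf
  set u : ℝ → ℝ → ℝ := fun t => u₁ (max t 0) with hu
  have hgen' : genericity (u 0) = D := by simpa [hu] using hgen
  have hv0 : ∀ x, |v 0 x| ≤ D := fun x => hgen' ▸ H.abs_v_zero_le x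
  have hvle : ∀ {t}, 0 ≤ t → ∀ x, v t x ≤ D := fun ht x =>
    H.v_le hν.le hconv (fun x => (abs_le.mp (hv0 x)).2) ht x
  have hfu : ∀ {t}, 0 ≤ t → ∀ x, |f (u t x)| ≤ B := fun ht x =>
    hB _ (H.abs_u_le hD.le (hvle ht) x)
  have hflux : ∀ x, -(B + D) ≤ ν * v t x - f (u t x) := H.le_flux hf hν.le (fun x => by
    have h1 := (abs_le.mp (hfu le_rfl x)).2
    have h2 := (abs_le.mp (hv0 x)).1
    nlinarith) ht
  -- The flux bound gives νv ≥ -(2B + D); from above, νv ≤ D because ν ≤ 1.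
  have habs : ∀ x, |v t x| ≤ (2 * B + 2 * D) * ν⁻¹ := fun x => by
    rw [← div_eq_mul_inv, le_div_iff₀ hν,
      show |v t x| * ν = |v t x * ν| by rw [abs_mul, abs_of_pos hν], abs_le]
    have h1 := (abs_le.mp (hfu ht x)).1
    have h2 := hflux x
    have h3 := hvle ht x
    constructor
    · linarith
    · nlinarith
  have hvc := continuous_slice H.continuous_v t
  have hut : u₁ t = u t := by simp [hu, max_eq_left ht]
  calc sqNormH1 (u₁ t) = ∫ x in (0 : ℝ)..1, v t x ^ 2 := by rw [hut, H.sqNormH1_eq]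
    _ ≤ ∫ x in (0 : ℝ)..1, (2 * B + 2 * D) * ν⁻¹ * |v t x| := by
      refine integral_mono_on zero_le_one ((hvc.pow 2).intervalIntegrable _ _)
        ((continuous_const.mul hvc.abs).intervalIntegrable _ _) fun x _ => ?_
      rw [← sq_abs, sq]
      exact mul_le_mul_of_nonneg_right (habs x) (abs_nonneg _)
    _ = (2 * B + 2 * D) * ν⁻¹ * ∫ x in (0 : ℝ)..1, |v t x| := by
      rw [intervalIntegral.integral_const_mul]
    _ ≤ (2 * B + 2 * D) * ν⁻¹ * (2 * D) := by
      refine mul_le_mul_of_nonneg_left ?_ (by positivity)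
      exact integral_abs_deriv_le (H.periodic t) (H.hasDerivAt_u t) hvc hD.le (hvle ht)
    _ = (2 * B + 2 * D) * (2 * D) * ν⁻¹ := by ring

/-! ### Structure function and energy flux -/

theorem hasDerivAt_double_integral {F F' : ℝ → ℝ → ℝ → ℝ}
    (hF : Continuous fun p : (ℝ × ℝ) × ℝ => F p.1.1 p.1.2 p.2)
    (hF' : Continuous fun p : (ℝ × ℝ) × ℝ => F' p.1.1 p.1.2 p.2)
    (h : ∀ l t x, HasDerivAt (fun s => F s t x) (F' l t x) l) (a b c d l : ℝ) :
    HasDerivAt (fun s => ∫ t in a..b, ∫ x in c..d, F s t x)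
      (∫ t in a..b, ∫ x in c..d, F' l t x) l := by
  refine hasDerivAt_intervalIntegral (p := fun s t => ∫ x in c..d, F s t x)
    (q := fun s t => ∫ x in c..d, F' s t x)
    (continuous_intervalIntegral (F := fun (p : ℝ × ℝ) x => F p.1 p.2 x) hF c d)
    (continuous_intervalIntegral (F := fun (p : ℝ × ℝ) x => F' p.1 p.2 x) hF' c d)
    (fun s t => ?_) a b l
  exact hasDerivAt_intervalIntegral (p := fun s x => F s t x) (q := fun s x => F' s t x)
    (hF.comp (by fun_prop : Continuous fun p : ℝ × ℝ => ((p.1, t), p.2)))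
    (hF'.comp (by fun_prop : Continuous fun p : ℝ × ℝ => ((p.1, t), p.2)))
    (fun s x => h s t x) c d s

/-- The autocorrelation `∫ g(x) g(x + l) dx`. -/
noncomputable def autocorrelation (g : ℝ → ℝ) (l : ℝ) : ℝ := ∫ x in (0 : ℝ)..1, g x * g (x + l)

/-- The structure function `∫ (g(x + l) - g(x))² dx` of order two. -/
noncomputable def structureFunction (g : ℝ → ℝ) (l : ℝ) : ℝ :=
  ∫ x in (0 : ℝ)..1, (g (x + l) - g x) ^ 2

theorem autocorrelation_eq {g : ℝ → ℝ} (hg : Function.Periodic g 1) (hc : Continuous g) (l : ℝ) :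
    autocorrelation g l = autocorrelation g 0 - structureFunction g l / 2 := by
  have h1 : ∫ x in (0 : ℝ)..1, g (x + l) ^ 2 = ∫ x in (0 : ℝ)..1, g x ^ 2 :=
    integral_comp_add_of_periodic (g := fun x => g x ^ 2) (fun x => by simp only [hg x]) l
  have h2 : structureFunction g l = (∫ x in (0 : ℝ)..1, g (x + l) ^ 2) +
      (∫ x in (0 : ℝ)..1, g x ^ 2) - 2 * autocorrelation g l := by
    rw [structureFunction, autocorrelation, ← intervalIntegral.integral_const_mul,
      ← intervalIntegral.integral_add, ← intervalIntegral.integral_sub]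
    · exact intervalIntegral.integral_congr fun x _ => by ring
    all_goals exact Continuous.intervalIntegrable (by fun_prop) _ _
  have h3 : autocorrelation g 0 = ∫ x in (0 : ℝ)..1, g x ^ 2 :=
    intervalIntegral.integral_congr fun x _ => by simp only [add_zero]; ring
  rw [h2, h1, h3]
  ring

theorem structureFunction_nonneg (g : ℝ → ℝ) (l : ℝ) : 0 ≤ structureFunction g l :=
  integral_nonneg zero_le_one fun _ _ => sq_nonneg _

/-- The increment δ satisfies both |δ| ≤ 2m and |δ| ≤ 2ml - δ. Multiply the two and use that δ has
mean zero. -/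
theorem structureFunction_le {g g' : ℝ → ℝ} {m l : ℝ} (hg : Function.Periodic g 1)
    (h : ∀ x, HasDerivAt g (g' x) x) (h0 : ∫ x in (0 : ℝ)..1, g x = 0) (hm0 : 0 ≤ m)
    (hm : ∀ x, g' x ≤ m) (hl : 0 ≤ l) : structureFunction g l ≤ 4 * m ^ 2 * l := by
  have hc : Continuous g := continuous_iff_continuousAt.mpr fun x => (h x).continuousAt
  have hb := abs_le_of_hasDerivAt_le hg h h0 hm0 hm
  have h1 : structureFunction g l ≤
      ∫ x in (0 : ℝ)..1, (4 * m ^ 2 * l - 2 * m * (g (x + l) - g x)) := by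
    refine integral_mono_on zero_le_one (Continuous.intervalIntegrable (by fun_prop) _ _)
      (Continuous.intervalIntegrable (by fun_prop) _ _) fun x _ => ?_
    have h2 := sub_le_mul_of_hasDerivAt_le h hm (show x ≤ x + l by linarith)
    have h3 : |g (x + l) - g x| ≤ 2 * m := by
      rw [abs_le]
      constructor <;> linarith [(abs_le.mp (hb x)).1, (abs_le.mp (hb x)).2,
        (abs_le.mp (hb (x + l))).1, (abs_le.mp (hb (x + l))).2]
    have h4 : |g (x + l) - g x| ≤ 2 * m * l - (g (x + l) - g x) := by
      have := mul_nonneg hm0 hl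
      rw [abs_le]
      constructor <;> linarith
    rw [← sq_abs, sq]
    have := mul_le_mul h3 h4 (abs_nonneg _) (by linarith)
    linarith
  rw [intervalIntegral.integral_sub, intervalIntegral.integral_const_mul (2 * m),
    intervalIntegral.integral_sub, integral_comp_add_of_periodic hg] at h1
  · simpa using h1
  all_goals exact Continuous.intervalIntegrable (by fun_prop) _ _

/-- The error of the trapezoidal rule. -/
theorem abs_trapezoid_le {f F : ℝ → ℝ} {Λ D a b : ℝ} (hF : ∀ y, HasDerivAt F (f y) y)
    (hf : ∀ y y', |y| ≤ D → |y'| ≤ D → |f y - f y'| ≤ Λ * |y - y'|)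
    (ha : |a| ≤ D) (hb : |b| ≤ D) :
    |(f a + f b) * (b - a) - 2 * (F b - F a)| ≤ 2 * Λ * (b - a) ^ 2 := by
  have hmem : ∀ s ∈ uIcc a b, |s| ≤ D := fun s hs =>
    abs_le.mpr ((convex_Icc (-D) D).ordConnected.uIcc_subset (abs_le.mp ha) (abs_le.mp hb) hs)
  -- The one-point rule at c has error at most Λ(b-a)²; adding the rules at c = a and c = b gives
  -- the trapezoid. This quadratic order is what matches the structure function.
  have hone : ∀ c ∈ uIcc a b, |F b - F a - f c * (b - a)| ≤ Λ * (b - a) ^ 2 := fun c hc => by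
    have hΛ : ∀ s ∈ uIcc a b, |f s - f c| ≤ Λ * |b - a| := fun s hs => by
      refine (hf s c (hmem s hs) (hmem c hc)).trans ?_
      -- The sign of Λ is not assumed; it follows from the Lipschitz hypothesis only when a ≠ b.
      rcases eq_or_ne a b with rfl | hab
      · simp only [uIcc_self, mem_singleton_iff] at hs hc
        simp [hs, hc]
      · have hΛ0 : 0 ≤ Λ := by
          have := (abs_nonneg _).trans (hf a b ha hb)
          exact nonneg_of_mul_nonneg_left this (abs_pos.mpr (sub_ne_zero.mpr hab))
        exact mul_le_mul_of_nonneg_left (abs_sub_le_of_uIcc_subset_uIcc (uIcc_subset_uIcc hc hs)) hΛ0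
    have := (convex_uIcc a b).norm_image_sub_le_of_norm_hasDerivWithin_le
      (f := fun s => F s - f c * s) (f' := fun s => f s - f c * 1)
      (fun s _ => ((hF s).sub ((hasDerivAt_id s).const_mul (f c))).hasDerivWithinAt)
      (C := Λ * |b - a|) (fun s hs => by simpa using hΛ s hs) left_mem_uIcc right_mem_uIcc
    simp only [Real.norm_eq_abs] at this
    rw [mul_assoc, ← sq, sq_abs] at this
    rwa [show F b - F a - f c * (b - a) = F b - f c * b - (F a - f c * a) by ring]
  have h1 := abs_le.mp (hone a left_mem_uIcc)
  have h2 := abs_le.mp (hone b right_mem_uIcc)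
  rw [abs_le]
  constructor <;> linarith [h1.1, h1.2, h2.1, h2.2]

theorem exists_lipschitz_bound {f : ℝ → ℝ} (hf : ContDiff ℝ ∞ f) (D : ℝ) :
    ∃ Λ, 0 ≤ Λ ∧ ∀ y y', |y| ≤ D → |y'| ≤ D → |f y - f y'| ≤ Λ * |y - y'| := by
  obtain ⟨Λ, h0, hΛ⟩ := exists_bound_on_Icc (contDiff_infty_iff_deriv.mp hf).2.continuous D
  refine ⟨Λ, h0, fun y y' hy hy' => ?_⟩
  exact (convex_Icc (-D) D).norm_image_sub_le_of_norm_deriv_le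
    (fun s _ => hf.differentiable (by simp) s) (fun s hs => hΛ s (abs_le.mpr hs))
    (abs_le.mp hy') (abs_le.mp hy)

/-- The integrand of the energy flux through the scale `l`. -/
noncomputable def fluxIntegrand (f : ℝ → ℝ) (ν : ℝ) (u v : ℝ → ℝ → ℝ) (l t x : ℝ) : ℝ :=
  f (u t x) * u t (x + l) - u t x * f (u t (x + l)) + 2 * ν * (u t x * v t (x + l))

/-- The derivative of `fluxIntegrand` with respect to `l`. -/
noncomputable def fluxDerivIntegrand (f : ℝ → ℝ) (ν : ℝ) (u v w : ℝ → ℝ → ℝ) (l t x : ℝ) : ℝ :=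
  f (u t x) * v t (x + l) - u t x * (deriv f (u t (x + l)) * v t (x + l)) +
    2 * ν * (u t x * w t (x + l))

namespace IsFlow

variable {f : ℝ → ℝ} {ν : ℝ} {u v w z : ℝ → ℝ → ℝ}

theorem continuous_fluxIntegrand (H : IsFlow f ν u v w z) (hf : ContDiff ℝ ∞ f) :
    Continuous fun p : (ℝ × ℝ) × ℝ => fluxIntegrand f ν u v p.1.1 p.1.2 p.2 := by
  have hfc := hf.continuous
  have hu : Continuous fun p : (ℝ × ℝ) × ℝ => u p.1.2 p.2 :=
    H.continuous_u.comp (by fun_prop : Continuous fun p : (ℝ × ℝ) × ℝ => (p.1.2, p.2))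
  have hul : Continuous fun p : (ℝ × ℝ) × ℝ => u p.1.2 (p.2 + p.1.1) :=
    H.continuous_u.comp (by fun_prop : Continuous fun p : (ℝ × ℝ) × ℝ => (p.1.2, p.2 + p.1.1))
  have hvl : Continuous fun p : (ℝ × ℝ) × ℝ => v p.1.2 (p.2 + p.1.1) :=
    H.continuous_v.comp (by fun_prop : Continuous fun p : (ℝ × ℝ) × ℝ => (p.1.2, p.2 + p.1.1))
  exact (((hfc.comp hu).mul hul).sub (hu.mul (hfc.comp hul))).add
    (continuous_const.mul (hu.mul hvl))

theorem continuous_fluxDerivIntegrand (H : IsFlow f ν u v w z) (hf : ContDiff ℝ ∞ f) :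
    Continuous fun p : (ℝ × ℝ) × ℝ => fluxDerivIntegrand f ν u v w p.1.1 p.1.2 p.2 := by
  have hfc := hf.continuous
  have hfc' := (contDiff_infty_iff_deriv.mp hf).2.continuous
  have hu : Continuous fun p : (ℝ × ℝ) × ℝ => u p.1.2 p.2 :=
    H.continuous_u.comp (by fun_prop : Continuous fun p : (ℝ × ℝ) × ℝ => (p.1.2, p.2))
  have hul : Continuous fun p : (ℝ × ℝ) × ℝ => u p.1.2 (p.2 + p.1.1) :=
    H.continuous_u.comp (by fun_prop : Continuous fun p : (ℝ × ℝ) × ℝ => (p.1.2, p.2 + p.1.1))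
  have hvl : Continuous fun p : (ℝ × ℝ) × ℝ => v p.1.2 (p.2 + p.1.1) :=
    H.continuous_v.comp (by fun_prop : Continuous fun p : (ℝ × ℝ) × ℝ => (p.1.2, p.2 + p.1.1))
  have hwl : Continuous fun p : (ℝ × ℝ) × ℝ => w p.1.2 (p.2 + p.1.1) :=
    H.continuous_w.comp (by fun_prop : Continuous fun p : (ℝ × ℝ) × ℝ => (p.1.2, p.2 + p.1.1))
  exact (((hfc.comp hu).mul hvl).sub (hu.mul ((hfc'.comp hul).mul hvl))).add
    (continuous_const.mul (hu.mul hwl))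

/-- The balance of the autocorrelation. -/
theorem autocorrelation_sub (H : IsFlow f ν u v w z) (hf : ContDiff ℝ ∞ f) {a b : ℝ}
    (ha : 0 ≤ a) (hab : a ≤ b) (l : ℝ) :
    autocorrelation (u b) l - autocorrelation (u a) l =
      ∫ t in a..b, ∫ x in (0 : ℝ)..1, fluxDerivIntegrand f ν u v w l t x := by
  have hfc := hf.continuous
  have hfc' := (contDiff_infty_iff_deriv.mp hf).2.continuous
  have hu := H.continuous_u
  have hv := H.continuous_v
  have hw := H.continuous_w
  have hul : Continuous fun p : ℝ × ℝ => u p.1 (p.2 + l) :=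
    H.continuous_u.comp (by fun_prop : Continuous fun p : ℝ × ℝ => (p.1, p.2 + l))
  have hvl : Continuous fun p : ℝ × ℝ => v p.1 (p.2 + l) :=
    H.continuous_v.comp (by fun_prop : Continuous fun p : ℝ × ℝ => (p.1, p.2 + l))
  have hwl : Continuous fun p : ℝ × ℝ => w p.1 (p.2 + l) :=
    H.continuous_w.comp (by fun_prop : Continuous fun p : ℝ × ℝ => (p.1, p.2 + l))
  set ut : ℝ → ℝ → ℝ := fun t x => -(deriv f (u t x) * v t x) + ν * w t x with hut
  have hcont : Continuous fun p : ℝ × ℝ =>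
      ut p.1 p.2 * u p.1 (p.2 + l) + u p.1 p.2 * ut p.1 (p.2 + l) := by
    simp only [hut]
    fun_prop
  have h1 := integral_sub_integral_of_hasDerivAt (p := fun t x => u t x * u t (x + l))
    (q := fun t x => ut t x * u t (x + l) + u t x * ut t (x + l)) (hu.mul hul) hcont hab
    (fun t ht x => (H.time_u t (ha.trans_lt ht.1) x).mul
      (H.time_u t (ha.trans_lt ht.1) (x + l))) 0 1
  refine h1.trans (intervalIntegral.integral_congr fun t _ => ?_)
  have hK : Continuous fun x => fluxDerivIntegrand f ν u v w l t x :=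
    (H.continuous_fluxDerivIntegrand hf).comp
      (by fun_prop : Continuous fun x : ℝ => ((l, t), x))
  have hq : Continuous fun x => ut t x * u t (x + l) + u t x * ut t (x + l) :=
    hcont.comp (by fun_prop : Continuous fun x : ℝ => (t, x))
  refine sub_eq_zero.mp ?_
  rw [← intervalIntegral.integral_sub (hq.intervalIntegrable _ _) (hK.intervalIntegrable _ _)]
  have hfd : ∀ x, HasDerivAt (fun x => f (u t x)) (deriv f (u t x) * v t x) x := fun x =>
    ((hf.differentiable (by simp) (u t x)).hasDerivAt).comp x (H.hasDerivAt_u t x)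
  have hul' : ∀ x, HasDerivAt (fun x => u t (x + l)) (v t (x + l)) x := fun x =>
    (H.hasDerivAt_u t (x + l)).comp_add_const x l
  have hvl' : ∀ x, HasDerivAt (fun x => v t (x + l)) (w t (x + l)) x := fun x =>
    (H.hasDerivAt_v t (x + l)).comp_add_const x l
  -- The boundary term of the integrations by parts that move all x-derivatives onto the shifted
  -- factor.
  refine integral_eq_zero_of_periodic
    (g := fun x => -(f (u t x) * u t (x + l)) + ν * (v t x * u t (x + l) - u t x * v t (x + l)))
    (fun x => ?_) (fun x => ?_) (hq.sub hK)
  · have e1 := H.periodic t x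
    have e2 := H.periodic t (x + l)
    have e3 := H.periodic_v t x
    have e4 := H.periodic_v t (x + l)
    simp only [add_right_comm x 1 l, e1, e2, e3, e4]
  · refine (((hfd x).mul (hul' x)).neg.add
      ((((H.hasDerivAt_v t x).mul (hul' x)).sub
        ((H.hasDerivAt_u t x).mul (hvl' x))).const_mul ν)).congr_deriv ?_
    simp only [hut, fluxDerivIntegrand]
    ring

theorem hasDerivAt_fluxIntegrand (H : IsFlow f ν u v w z) (hf : ContDiff ℝ ∞ f) (l t x : ℝ) :
    HasDerivAt (fun s => fluxIntegrand f ν u v s t x) (fluxDerivIntegrand f ν u v w l t x) l := by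
  have h1 : HasDerivAt (fun s => u t (x + s)) (v t (x + l)) l :=
    (H.hasDerivAt_u t (x + l)).comp_const_add x l
  have h2 : HasDerivAt (fun s => v t (x + s)) (w t (x + l)) l :=
    (H.hasDerivAt_v t (x + l)).comp_const_add x l
  have h3 : HasDerivAt (fun s => f (u t (x + s))) (deriv f (u t (x + l)) * v t (x + l)) l :=
    ((hf.differentiable (by simp) (u t (x + l))).hasDerivAt).comp l h1
  exact ((h1.const_mul (f (u t x))).sub (h3.const_mul (u t x))).add
    ((h2.const_mul (u t x)).const_mul (2 * ν))

/-- The derivative of the total flux through the scale `l` is the change of autocorrelation. -/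
theorem hasDerivAt_flux (H : IsFlow f ν u v w z) (hf : ContDiff ℝ ∞ f) {a b : ℝ}
    (ha : 0 ≤ a) (hab : a ≤ b) (l : ℝ) :
    HasDerivAt (fun s => ∫ t in a..b, ∫ x in (0 : ℝ)..1, fluxIntegrand f ν u v s t x)
      (autocorrelation (u b) l - autocorrelation (u a) l) l := by
  rw [H.autocorrelation_sub hf ha hab]
  exact hasDerivAt_double_integral (H.continuous_fluxIntegrand hf)
    (H.continuous_fluxDerivIntegrand hf) (H.hasDerivAt_fluxIntegrand hf) a b 0 1 l

theorem integral_fluxIntegrand_zero (H : IsFlow f ν u v w z) (t : ℝ) :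
    ∫ x in (0 : ℝ)..1, fluxIntegrand f ν u v 0 t x = 0 := by
  have hu := continuous_slice H.continuous_u t
  have hv := continuous_slice H.continuous_v t
  have h := integral_eq_zero_of_periodic (g := fun x => ν * u t x ^ 2)
    (g' := fun x => 2 * ν * (u t x * v t x))
    (fun x => by simp only [H.periodic t x])
    (fun x => (((H.hasDerivAt_u t x).pow 2).const_mul ν).congr_deriv (by push_cast; ring))
    (by fun_prop)
  refine Eq.trans ?_ h
  exact intervalIntegral.integral_congr fun x _ => by simp only [fluxIntegrand, add_zero]; ring

theorem exists_antiderivative (hf : Continuous f) : ∃ F : ℝ → ℝ, ∀ y, HasDerivAt F (f y) y :=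
  ⟨fun y => ∫ s in (0 : ℝ)..y, f s, fun _ => integral_hasDerivAt_right
    (hf.intervalIntegrable _ _) (hf.stronglyMeasurableAtFilter _ _) hf.continuousAt⟩

/-- The energy identity. -/
theorem integral_fluxDerivIntegrand_zero (H : IsFlow f ν u v w z) (hf : ContDiff ℝ ∞ f) (t : ℝ) :
    ∫ x in (0 : ℝ)..1, fluxDerivIntegrand f ν u v w 0 t x =
      -(2 * ν * ∫ x in (0 : ℝ)..1, v t x ^ 2) := by
  obtain ⟨F, hF⟩ := exists_antiderivative hf.continuous
  have hv := continuous_slice H.continuous_v t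
  have hK : Continuous fun x => fluxDerivIntegrand f ν u v w 0 t x :=
    (H.continuous_fluxDerivIntegrand hf).comp
      (by fun_prop : Continuous fun x : ℝ => (((0 : ℝ), t), x))
  -- The inviscid contribution is an exact derivative, so only the viscous dissipation survives.
  have h := integral_eq_zero_of_periodic
    (g := fun x => 2 * F (u t x) - u t x * f (u t x) + 2 * ν * (u t x * v t x))
    (g' := fun x => fluxDerivIntegrand f ν u v w 0 t x + 2 * ν * v t x ^ 2)
    (fun x => by simp only [H.periodic t x, H.periodic_v t x])
    (fun x => by
      have h0 := H.hasDerivAt_u t x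
      have h1 := (hF (u t x)).comp x h0
      have h2 := ((hf.differentiable (by simp) (u t x)).hasDerivAt).comp x h0
      refine (((h1.const_mul 2).sub (h0.mul h2)).add
        ((h0.mul (H.hasDerivAt_v t x)).const_mul (2 * ν))).congr_deriv ?_
      simp only [fluxDerivIntegrand, add_zero, Function.comp]
      ring)
    (by fun_prop)
  rw [intervalIntegral.integral_add (hK.intervalIntegrable _ _)
    (Continuous.intervalIntegrable (by fun_prop) _ _),
    intervalIntegral.integral_const_mul] at h
  linarith

/-- The flux is controlled by the structure function and its derivative. -/
theorem flux_lower_bound (H : IsFlow f ν u v w z) (hf : ContDiff ℝ ∞ f) {D Λ t : ℝ}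
    (hΛ : ∀ y y', |y| ≤ D → |y'| ≤ D → |f y - f y'| ≤ Λ * |y - y'|)
    (hu : ∀ x, |u t x| ≤ D) (l : ℝ) :
    0 ≤ (∫ x in (0 : ℝ)..1, fluxIntegrand f ν u v l t x) +
      2 * Λ * structureFunction (u t) l +
      ν * ∫ x in (0 : ℝ)..1, 2 * (u t (x + l) - u t x) * v t (x + l) := by
  obtain ⟨F, hF⟩ := exists_antiderivative hf.continuous
  have hfc := hf.continuous
  have hFc : Continuous F := continuous_iff_continuousAt.mpr fun x => (hF x).continuousAt
  have huc := continuous_slice H.continuous_u t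
  have hvc := continuous_slice H.continuous_v t
  have hK : Continuous fun x => fluxIntegrand f ν u v l t x :=
    (H.continuous_fluxIntegrand hf).comp (by fun_prop : Continuous fun x : ℝ => ((l, t), x))
  have hχ : ∫ x in (0 : ℝ)..1, (2 * F (u t (x + l)) - u t (x + l) * f (u t (x + l))) =
      ∫ x in (0 : ℝ)..1, (2 * F (u t x) - u t x * f (u t x)) :=
    integral_comp_add_of_periodic (g := fun x => 2 * F (u t x) - u t x * f (u t x))
      (fun x => by simp only [H.periodic t x]) l
  have huv : ∫ x in (0 : ℝ)..1, ν * (2 * (u t (x + l) * v t (x + l))) = 0 :=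
    integral_eq_zero_of_periodic (g := fun x => ν * u t (x + l) ^ 2)
      (fun x => by simp only [add_right_comm x 1 l, H.periodic t (x + l)])
      (fun x => ((((H.hasDerivAt_u t (x + l)).comp_add_const x l).pow 2).const_mul ν).congr_deriv
        (by push_cast; ring)) (by fun_prop)
  -- The subtracted terms integrate to zero. The first completes f(u)u⁺ - u f(u⁺) to the trapezoidal
  -- error with a = u, b = u⁺; the second turns 2νuv⁺ into -2ν(u⁺ - u)v⁺, whose integral is -ν∂S/∂l.
  have hnn : 0 ≤ ∫ x in (0 : ℝ)..1, (fluxIntegrand f ν u v l t x +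
      2 * Λ * (u t (x + l) - u t x) ^ 2 + ν * (2 * (u t (x + l) - u t x) * v t (x + l)) -
      ((2 * F (u t (x + l)) - u t (x + l) * f (u t (x + l))) -
        (2 * F (u t x) - u t x * f (u t x))) -
      ν * (2 * (u t (x + l) * v t (x + l)))) := by
    refine integral_nonneg zero_le_one fun x _ => ?_
    have := (abs_le.mp (abs_trapezoid_le hF hΛ (hu x) (hu (x + l)))).1
    simp only [fluxIntegrand]
    linarith
  rw [intervalIntegral.integral_sub, intervalIntegral.integral_sub, intervalIntegral.integral_add,
    intervalIntegral.integral_add, intervalIntegral.integral_sub, huv, hχ,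
    intervalIntegral.integral_const_mul, intervalIntegral.integral_const_mul] at hnn
  · simpa [structureFunction] using hnn
  all_goals exact Continuous.intervalIntegrable (by fun_prop) _ _

end IsFlow

/-- A differential inequality `κ φ + φ' ≥ c s` forces linear growth of `φ`. -/
theorem linear_growth_of_le_deriv {φ φ' : ℝ → ℝ} {κ c l r : ℝ} (hκ : 0 ≤ κ) (hc : 0 ≤ c)
    (hr : 0 ≤ r) (hrl : r ≤ l) (hφ0 : ∀ s, 0 ≤ φ s) (hφ : ∀ s, HasDerivAt φ (φ' s) s)
    (h : ∀ s, 0 ≤ s → s ≤ l → c * s ≤ κ * φ s + φ' s) :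
    Real.exp (-(κ * r / 2)) * (c * l / 2) * (r / 2) ≤ φ l := by
  have hψ : ∀ s, HasDerivAt (fun s => Real.exp (κ * (s - l)) * φ s)
      (Real.exp (κ * (s - l)) * (κ * φ s + φ' s)) s := fun s => by
    have h1 : HasDerivAt (fun s => Real.exp (κ * (s - l)))
        (Real.exp (κ * (s - l)) * (κ * 1)) s :=
      (((hasDerivAt_id s).sub_const l).const_mul κ).exp
    exact (h1.mul (hφ s)).congr_deriv (by ring)
  -- With the integrating factor exp(κ(s - l)), the mean value inequality is applied on [l - r/2,
  -- l]; there s ≥ l/2, since r ≤ l.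
  have hmv := (convex_Icc (l - r / 2) l).mul_sub_le_image_sub_of_le_deriv
    (f := fun s => Real.exp (κ * (s - l)) * φ s)
    (C := Real.exp (-(κ * r / 2)) * (c * l / 2))
    (fun s _ => (hψ s).continuousAt.continuousWithinAt)
    (fun s _ => (hψ s).differentiableAt.differentiableWithinAt)
    (fun s hs => by
      rw [interior_Icc] at hs
      rw [(hψ s).deriv]
      have hs0 : l / 2 ≤ s := by linarith [hs.1]
      have h1 := h s (by linarith) hs.2.le
      have h2 : c * l / 2 ≤ c * s := by nlinarith
      refine mul_le_mul (Real.exp_le_exp.mpr ?_) (h2.trans h1) ?_ (Real.exp_pos _).le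
      · nlinarith [hs.1]
      · have : 0 ≤ l := hr.trans hrl
        positivity)
    (l - r / 2) ⟨le_rfl, by linarith⟩ l ⟨by linarith, le_rfl⟩ (by linarith)
  have h3 : 0 ≤ Real.exp (κ * (l - r / 2 - l)) * φ (l - r / 2) :=
    mul_nonneg (Real.exp_pos _).le (hφ0 _)
  simp only [sub_self, mul_zero, Real.exp_zero, one_mul, sub_sub_cancel] at hmv
  linarith

/-! ### Lower bound for the time-integrated structure function -/

namespace IsFlow

variable {f : ℝ → ℝ} {ν : ℝ} {u v w z : ℝ → ℝ → ℝ}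

theorem continuous_structureFunction (H : IsFlow f ν u v w z) (l : ℝ) :
    Continuous fun t => structureFunction (u t) l := by
  have hu := H.continuous_u
  have hul : Continuous fun p : ℝ × ℝ => u p.1 (p.2 + l) :=
    H.continuous_u.comp (by fun_prop : Continuous fun p : ℝ × ℝ => (p.1, p.2 + l))
  exact continuous_intervalIntegral (F := fun t x => (u t (x + l) - u t x) ^ 2)
    ((hul.sub hu).pow 2) 0 1

/-- The lower bound for the time integral of the structure function over an interval on which a
definite amount of energy is dissipated. -/
theorem le_integral_structureFunction (H : IsFlow f ν u v w z) (hf : ContDiff ℝ ∞ f)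
    (hν : 0 < ν) {D Λ : ℝ} (hD : 0 ≤ D) (hΛ0 : 0 ≤ Λ)
    (hΛ : ∀ y y', |y| ≤ D → |y'| ≤ D → |f y - f y'| ≤ Λ * |y - y'|)
    (hv : ∀ t, 0 ≤ t → ∀ x, v t x ≤ D) {a b ε : ℝ} (ha : 0 ≤ a) (hab : a ≤ b) (hε : 0 ≤ ε)
    (hdrop : autocorrelation (u b) 0 - autocorrelation (u a) 0 ≤ -ε) {l r : ℝ} (hr : 0 ≤ r)
    (hrl : r * ν ≤ l) (hl : 4 * D ^ 2 * l ≤ ε) :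
    Real.exp (-(Λ * r)) * (ε * r / 8) * l ≤ ∫ t in a..b, structureFunction (u t) l := by
  have hl0 : 0 ≤ l := (mul_nonneg hr hν.le).trans hrl
  have hu : ∀ t, 0 ≤ t → ∀ x, |u t x| ≤ D := fun t ht => H.abs_u_le hD (hv t ht)
  set φ : ℝ → ℝ := fun s => ∫ t in a..b, structureFunction (u t) s with hφ
  set I : ℝ → ℝ → ℝ := fun s t => ∫ x in (0 : ℝ)..1, 2 * (u t (x + s) - u t x) * v t (x + s)
    with hI
  have cu : Continuous fun p : (ℝ × ℝ) × ℝ => u p.1.2 p.2 :=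
    H.continuous_u.comp (by fun_prop : Continuous fun p : (ℝ × ℝ) × ℝ => (p.1.2, p.2))
  have cul : Continuous fun p : (ℝ × ℝ) × ℝ => u p.1.2 (p.2 + p.1.1) :=
    H.continuous_u.comp (by fun_prop : Continuous fun p : (ℝ × ℝ) × ℝ => (p.1.2, p.2 + p.1.1))
  have cvl : Continuous fun p : (ℝ × ℝ) × ℝ => v p.1.2 (p.2 + p.1.1) :=
    H.continuous_v.comp (by fun_prop : Continuous fun p : (ℝ × ℝ) × ℝ => (p.1.2, p.2 + p.1.1))
  have cI : Continuous fun p : (ℝ × ℝ) × ℝ =>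
      2 * (u p.1.2 (p.2 + p.1.1) - u p.1.2 p.2) * v p.1.2 (p.2 + p.1.1) :=
    (continuous_const.mul (cul.sub cu)).mul cvl
  have hφ' : ∀ s, HasDerivAt φ (∫ t in a..b, I s t) s := fun s =>
    hasDerivAt_double_integral (F := fun s t x => (u t (x + s) - u t x) ^ 2)
      (F' := fun s t x => 2 * (u t (x + s) - u t x) * v t (x + s)) ((cul.sub cu).pow 2) cI
      (fun s t x => (((H.hasDerivAt_u t (x + s)).comp_const_add x s |>.sub_const
        (u t x)).pow 2).congr_deriv (by push_cast; ring)) a b 0 1 s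
  have hIc : ∀ s, Continuous fun t => I s t := fun s =>
    continuous_intervalIntegral (F := fun t x => 2 * (u t (x + s) - u t x) * v t (x + s))
      (cI.comp (by fun_prop : Continuous fun p : ℝ × ℝ => ((s, p.1), p.2))) 0 1
  have hKc : ∀ s, Continuous fun t => ∫ x in (0 : ℝ)..1, fluxIntegrand f ν u v s t x := fun s =>
    continuous_intervalIntegral (F := fun t x => fluxIntegrand f ν u v s t x)
      ((H.continuous_fluxIntegrand hf).comp
        (by fun_prop : Continuous fun p : ℝ × ℝ => ((s, p.1), p.2))) 0 1
  have hflux : ∀ s, 0 ≤ s → s ≤ l →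
      ∫ t in a..b, ∫ x in (0 : ℝ)..1, fluxIntegrand f ν u v s t x ≤ -(ε / 2) * s := fun s hs hsl => by
    -- The slope is at most -ε plus half the structure function at time a, hence at most -ε + 2D²l ≤
    -- -ε/2.
    have hmv := (convex_Icc (0 : ℝ) s).image_sub_le_mul_sub_of_deriv_le
      (f := fun s => ∫ t in a..b, ∫ x in (0 : ℝ)..1, fluxIntegrand f ν u v s t x)
      (C := -(ε / 2))
      (fun y _ => (H.hasDerivAt_flux hf ha hab y).continuousAt.continuousWithinAt)
      (fun y _ => (H.hasDerivAt_flux hf ha hab y).differentiableAt.differentiableWithinAt)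
      (fun y hy => by
        rw [interior_Icc] at hy
        rw [(H.hasDerivAt_flux hf ha hab y).deriv,
          autocorrelation_eq (H.periodic b) (continuous_slice H.continuous_u b) y,
          autocorrelation_eq (H.periodic a) (continuous_slice H.continuous_u a) y]
        have h1 := structureFunction_nonneg (u b) y
        have h2 := structureFunction_le (H.periodic a) (H.hasDerivAt_u a) (H.zero_mean a) hD
          (hv a ha) hy.1.le
        have h3 : 4 * D ^ 2 * y ≤ 4 * D ^ 2 * l :=
          mul_le_mul_of_nonneg_left (hy.2.le.trans hsl) (by positivity)
        linarith)
      0 ⟨le_rfl, hs⟩ s ⟨hs, le_rfl⟩ hs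
    simpa [H.integral_fluxIntegrand_zero] using hmv
  have hineq : ∀ s, 0 ≤ s → s ≤ l →
      ε / (2 * ν) * s ≤ 2 * Λ / ν * φ s + ∫ t in a..b, I s t := fun s hs hsl => by
    have h1 : 0 ≤ ∫ t in a..b, ((∫ x in (0 : ℝ)..1, fluxIntegrand f ν u v s t x) +
        2 * Λ * structureFunction (u t) s + ν * I s t) :=
      integral_nonneg hab fun t ht =>
        H.flux_lower_bound hf hΛ (hu t (ha.trans ht.1)) s
    have cS := H.continuous_structureFunction s
    rw [intervalIntegral.integral_add, intervalIntegral.integral_add,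
      intervalIntegral.integral_const_mul, intervalIntegral.integral_const_mul] at h1
    · have h2 := hflux s hs hsl
      have h3 : ε / 2 * s ≤ 2 * Λ * φ s + ν * ∫ t in a..b, I s t := by linarith
      have h4 := mul_le_mul_of_nonneg_left h3 (inv_pos.mpr hν).le
      calc ε / (2 * ν) * s = ν⁻¹ * (ε / 2 * s) := by field_simp
        _ ≤ _ := h4
        _ = _ := by field_simp
    · exact (hKc s).intervalIntegrable _ _
    · exact (continuous_const.mul cS).intervalIntegrable _ _
    · exact ((hKc s).add (continuous_const.mul cS)).intervalIntegrable _ _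
    · exact (continuous_const.mul (hIc s)).intervalIntegrable _ _
  -- Here κ = 2Λ/ν, c = ε/(2ν) and the length is rν, so all powers of ν cancel.
  have hfin := linear_growth_of_le_deriv (by positivity) (by positivity) (by positivity) hrl
    (fun s => integral_nonneg hab fun t _ => structureFunction_nonneg (u t) s) hφ' hineq
  calc _ = _ := by
        rw [show -(2 * Λ / ν * (r * ν) / 2) = -(Λ * r) by field_simp]
        field_simp
        ring
    _ ≤ _ := hfin

/-- Between the times `T₁` and `T₂` a definite amount of energy is dissipated. -/
theorem energy_drop (H : IsFlow f ν u v w z) (hf : ContDiff ℝ ∞ f) (hν : 0 < ν) {σ D Ct : ℝ}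
    (hσ : 0 < σ) (hconv : ∀ x, σ ≤ deriv (deriv f) x) (hD : 0 < D) (hCt : 0 < Ct)
    (hL1 : D⁻¹ ≤ normL1 (u 0)) (hH1 : ∀ t, 0 ≤ t → sqNormH1 (u t) ≤ Ct * ν⁻¹) :
    autocorrelation (u (T₂ σ D Ct)) 0 - autocorrelation (u (T₁ D Ct)) 0 ≤ -(1 / 4 * (D ^ 2)⁻¹) := by
  -- Energy budget for |u|₂²: at least D⁻² initially (from the L¹ norm), at most D⁻²/2 lost by T₁
  -- (from the H¹ bound), at most D⁻²/4 left at T₂ (from Oleinik).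
  have hT1 : 0 < T₁ D Ct := by unfold T₁; positivity
  have hT2 : 2 * D * σ⁻¹ ≤ T₂ σ D Ct := le_max_right _ _
  have hT2pos : 0 < T₂ σ D Ct := lt_of_lt_of_le (by positivity) hT2
  have hend : autocorrelation (u (T₂ σ D Ct)) 0 ≤ 1 / 4 * (D ^ 2)⁻¹ := by
    have hv : ∀ x, v (T₂ σ D Ct) x ≤ 1 / (2 * D) := fun x => by
      have h1 := H.mul_v_le_one hν.le hσ hconv hT2pos.le x
      by_contra! hlt
      have hvpos : 0 < v (T₂ σ D Ct) x := lt_trans (by positivity) hlt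
      have h2 : 2 * D ≤ σ * T₂ σ D Ct := by
        rw [← div_eq_mul_inv, div_le_iff₀ hσ] at hT2
        linarith
      rw [div_lt_iff₀ (by positivity)] at hlt
      have h3 := mul_le_mul_of_nonneg_right h2 hvpos.le
      linarith
    have hu := H.abs_u_le (by positivity) hv
    have hc := continuous_slice H.continuous_u (T₂ σ D Ct)
    calc autocorrelation (u (T₂ σ D Ct)) 0 ≤ ∫ x in (0 : ℝ)..1, 1 / 4 * (D ^ 2)⁻¹ := by
          refine integral_mono_on zero_le_one (Continuous.intervalIntegrable (by fun_prop) _ _)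
            (intervalIntegrable_const) fun x _ => ?_
          have h1 := mul_le_mul (hu x) (hu x) (abs_nonneg _) (by positivity)
          rw [abs_mul_abs_self] at h1
          calc _ ≤ _ := by simpa only [add_zero] using h1
            _ = _ := by field_simp; norm_num
      _ = 1 / 4 * (D ^ 2)⁻¹ := by simp
  have hbegin : (D ^ 2)⁻¹ ≤ autocorrelation (u 0) 0 := by
    have hc := continuous_slice H.continuous_u 0
    have h1 : 0 ≤ ∫ x in (0 : ℝ)..1, (u 0 x * u 0 (x + 0) + D⁻¹ ^ 2 - 2 * D⁻¹ * |u 0 x|) := by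
      refine integral_nonneg zero_le_one fun x _ => ?_
      have h2 := sq_nonneg (|u 0 x| - D⁻¹)
      rw [add_zero, ← abs_mul_abs_self (u 0 x)]
      linarith
    rw [intervalIntegral.integral_sub, intervalIntegral.integral_add,
      intervalIntegral.integral_const_mul, intervalIntegral.integral_const] at h1
    · have h3 : 2 * D⁻¹ * D⁻¹ ≤ 2 * D⁻¹ * normL1 (u 0) :=
        mul_le_mul_of_nonneg_left hL1 (by positivity)
      simp only [sub_zero, one_smul] at h1
      rw [← inv_pow]
      unfold autocorrelation
      unfold normL1 at h3
      linarith
    all_goals exact Continuous.intervalIntegrable (by fun_prop) _ _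
  have hloss : -(1 / 2 * (D ^ 2)⁻¹) ≤ autocorrelation (u (T₁ D Ct)) 0 - autocorrelation (u 0) 0 := by
    rw [H.autocorrelation_sub hf le_rfl hT1.le]
    have hv2 : Continuous fun t => ∫ x in (0 : ℝ)..1, v t x ^ 2 :=
      continuous_intervalIntegral (F := fun t x => v t x ^ 2) (H.continuous_v.pow 2) 0 1
    simp only [H.integral_fluxDerivIntegrand_zero hf]
    calc -(1 / 2 * (D ^ 2)⁻¹) = ∫ t in (0 : ℝ)..T₁ D Ct, -(2 * ν * (Ct * ν⁻¹)) := by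
          rw [intervalIntegral.integral_const, T₁, smul_eq_mul]
          field_simp
          norm_num
      _ ≤ _ := by
          refine integral_mono_on hT1.le (intervalIntegrable_const)
            (Continuous.intervalIntegrable (by fun_prop) _ _) fun t ht => ?_
          have := hH1 t ht.1
          rw [H.sqNormH1_eq] at this
          have := mul_le_mul_of_nonneg_left this (mul_pos two_pos hν).le
          linarith
  linarith

end IsFlow

/-! ### Fourier coefficients -/

theorem fourierCoefficient_eq (g : ℝ → ℝ) (n : ℤ) :
    fourierCoefficient g n =
      ∫ x in (0 : ℝ)..1, Complex.exp (-(2 * Real.pi * Complex.I * n * x)) * g x := by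
  rw [fourierCoefficient, fourierCoeffOn_eq_integral]
  simp only [sub_zero, div_one, one_smul]
  refine intervalIntegral.integral_congr fun x _ => ?_
  simp only [smul_eq_mul]
  congr 1
  have := fourier_coe_apply (T := (1 : ℝ) - 0) (n := -n) (x := x)
  simp only [sub_zero] at this
  rw [this]
  congr 1
  push_cast
  ring

theorem exp_periodic (n : ℤ) (x : ℝ) :
    Complex.exp (-(2 * Real.pi * Complex.I * n * ((x + 1 : ℝ) : ℂ))) =
      Complex.exp (-(2 * Real.pi * Complex.I * n * x)) := by
  rw [Complex.exp_eq_exp_iff_exists_int]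
  exact ⟨-n, by push_cast; ring⟩

theorem fourierCoefficient_comp_add {g : ℝ → ℝ} (hg : Function.Periodic g 1) (n : ℤ) (l : ℝ) :
    fourierCoefficient (fun x => g (x + l)) n =
      Complex.exp (2 * Real.pi * Complex.I * n * l) * fourierCoefficient g n := by
  rw [fourierCoefficient_eq, fourierCoefficient_eq,
    ← integral_comp_add_of_periodic (g := fun x : ℝ =>
      Complex.exp (-(2 * Real.pi * Complex.I * n * x)) * (g x : ℂ))
      (fun x => by simp only [exp_periodic, hg x]) l,
    ← intervalIntegral.integral_const_mul]
  refine intervalIntegral.integral_congr fun x _ => ?_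
  rw [← mul_assoc, ← Complex.exp_add]
  congr 2
  push_cast
  ring

theorem norm_fourierCoefficient_le_integral (g : ℝ → ℝ) (n : ℤ) :
    ‖fourierCoefficient g n‖ ≤ ∫ x in (0 : ℝ)..1, |g x| := by
  rw [fourierCoefficient_eq]
  refine (intervalIntegral.norm_integral_le_integral_norm zero_le_one).trans_eq ?_
  refine intervalIntegral.integral_congr fun x _ => ?_
  have : -(2 * (Real.pi : ℂ) * Complex.I * n * x) =
      ((-(2 * Real.pi * n * x) : ℝ) : ℂ) * Complex.I := by
    push_cast
    ring
  simp only [norm_mul, Complex.norm_real, Real.norm_eq_abs]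
  rw [this, Complex.norm_exp_ofReal_mul_I, one_mul]

theorem norm_fourierCoefficient_le {g g' : ℝ → ℝ} {m : ℝ} (hg : Function.Periodic g 1)
    (h : ∀ x, HasDerivAt g (g' x) x) (hc : Continuous g') (hm0 : 0 ≤ m)
    (hm : ∀ x, g' x ≤ m) (n : ℤ) : ‖fourierCoefficient g n‖ * |(n : ℝ)| ≤ m := by
  rcases eq_or_ne n 0 with rfl | hn
  · simpa using hm0
  have h1 := (norm_fourierCoefficient_le_integral g' n).trans (integral_abs_deriv_le hg h hc hm0 hm)
  have hper : (g 1 : ℂ) - g 0 = 0 := by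
    have := hg 0
    rw [zero_add] at this
    rw [this, sub_self]
  have h2 := fourierCoeffOn_of_hasDerivAt (zero_lt_one (α := ℝ)) hn
    (f := fun x => (g x : ℂ)) (f' := fun x => (g' x : ℂ))
    (fun x _ => (h x).ofReal_comp) ((Complex.continuous_ofReal.comp hc).intervalIntegrable _ _)
  have h3 : fourierCoefficient g n = 1 / (-2 * Real.pi * Complex.I * n) *
      -fourierCoefficient g' n := by
    rw [fourierCoefficient, fourierCoefficient, h2]
    simp only [hper]
    simp
  have hn' : 0 < |(n : ℝ)| := abs_pos.mpr (Int.cast_ne_zero.mpr hn)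
  have h4 : ‖fourierCoefficient g n‖ * |(n : ℝ)| =
      (2 * Real.pi)⁻¹ * ‖fourierCoefficient g' n‖ := by
    rw [h3]
    simp only [norm_mul, norm_neg, norm_div, norm_one, Complex.norm_I, Complex.norm_real,
      Complex.norm_intCast, Real.norm_eq_abs, abs_of_pos Real.pi_pos, Complex.norm_ofNat]
    field_simp
  rw [h4, inv_mul_le_iff₀ (by positivity)]
  refine h1.trans ?_
  have : (1 : ℝ) ≤ Real.pi := by linarith [Real.pi_gt_three]
  nlinarith

/-- Parseval for the increment: a shift by l multiplies the n-th coefficient by exp(2πinl). -/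
theorem hasSum_structureFunction {g : ℝ → ℝ} (hg : Function.Periodic g 1) (hc : Continuous g)
    (l : ℝ) : HasSum
      (fun n : ℤ => ‖Complex.exp (2 * Real.pi * Complex.I * n * l) - 1‖ ^ 2 *
        ‖fourierCoefficient g n‖ ^ 2) (structureFunction g l) := by
  have hcδ : Continuous fun x => ((g (x + l) - g x : ℝ) : ℂ) := by fun_prop
  have hL2 : MemLp (fun x => ((g (x + l) - g x : ℝ) : ℂ)) 2 (volume.restrict (Ioc (0 : ℝ) 1)) :=
    (memLp_two_iff_integrable_sq_norm hcδ.aestronglyMeasurable).mpr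
      (hcδ.norm.pow 2).integrableOn_Ioc
  have h := hasSum_sq_fourierCoeffOn (zero_lt_one (α := ℝ)) hL2
  convert h using 1
  · funext n
    have : fourierCoeffOn (zero_lt_one (α := ℝ)) (fun x => ((g (x + l) - g x : ℝ) : ℂ)) n =
        (Complex.exp (2 * Real.pi * Complex.I * n * l) - 1) * fourierCoefficient g n := by
      rw [sub_mul, one_mul, ← fourierCoefficient_comp_add hg]
      change fourierCoefficient (fun x => g (x + l) - g x) n = _
      rw [fourierCoefficient_eq, fourierCoefficient_eq, fourierCoefficient_eq,
        ← intervalIntegral.integral_sub]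
      · refine intervalIntegral.integral_congr fun x _ => ?_
        push_cast
        ring
      all_goals exact Continuous.intervalIntegrable (by fun_prop) _ _
    rw [this, norm_mul, mul_pow]
  · simp only [structureFunction, Complex.norm_real, Real.norm_eq_abs, sq_abs, sub_zero, inv_one,
      one_smul]

theorem norm_exp_sub_one_le_two (n : ℤ) (l : ℝ) :
    ‖Complex.exp (2 * Real.pi * Complex.I * n * l) - 1‖ ≤ 2 := by
  have : 2 * (Real.pi : ℂ) * Complex.I * n * l = ((2 * Real.pi * n * l : ℝ) : ℂ) * Complex.I := by
    push_cast
    ring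
  rw [this]
  refine (norm_sub_le _ _).trans ?_
  rw [Complex.norm_exp_ofReal_mul_I, norm_one]
  norm_num

theorem norm_exp_sub_one_le (n : ℤ) {l : ℝ} (hl : 0 ≤ l) :
    ‖Complex.exp (2 * Real.pi * Complex.I * n * l) - 1‖ ≤ 2 * Real.pi * l * |(n : ℝ)| := by
  have : 2 * (Real.pi : ℂ) * Complex.I * n * l = Complex.I * ((2 * Real.pi * n * l : ℝ) : ℂ) := by
    push_cast
    ring
  rw [this]
  refine (Real.norm_exp_I_mul_ofReal_sub_one_le).trans_eq ?_
  rw [Real.norm_eq_abs, abs_mul, abs_mul, abs_mul, abs_of_pos Real.pi_pos, abs_of_nonneg hl]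
  norm_num
  ring

/-! ### Sums over frequencies -/

theorem sum_natAbs_le {s : Finset ℤ} {A : Finset ℕ} (hA : ∀ n ∈ s, n.natAbs ∈ A) {g : ℕ → ℝ}
    (hg : ∀ i, 0 ≤ g i) : ∑ n ∈ s, g n.natAbs ≤ 2 * ∑ i ∈ A, g i := by
  rw [← Finset.sum_fiberwise_of_maps_to hA, Finset.mul_sum]
  refine Finset.sum_le_sum fun i _ => ?_
  have h1 : ∑ n ∈ s with n.natAbs = i, g n.natAbs = ∑ n ∈ s with n.natAbs = i, g i :=
    Finset.sum_congr rfl fun n hn => by rw [(Finset.mem_filter.mp hn).2]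
  have h2 : (s.filter fun n => n.natAbs = i).card ≤ 2 := by
    refine (Finset.card_le_card (t := {(i : ℤ), -(i : ℤ)}) fun n hn => ?_).trans
      Finset.card_le_two
    have := (Finset.mem_filter.mp hn).2
    simp only [Finset.mem_insert, Finset.mem_singleton]
    omega
  rw [h1, Finset.sum_const, nsmul_eq_mul]
  exact mul_le_mul_of_nonneg_right (by exact_mod_cast h2) (hg i)

/-- Excluding n = 0 is what makes the bound proportional to y, even for y < 1. -/
theorem card_low_le {s : Finset ℤ} {y : ℝ} (hy : 0 ≤ y)
    (hs : ∀ n ∈ s, n ≠ 0 ∧ |(n : ℝ)| ≤ y) : (s.card : ℝ) ≤ 2 * y := by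
  have h := sum_natAbs_le (s := s) (A := Finset.Icc 1 ⌊y⌋₊) (g := fun _ => 1) (fun n hn => by
    obtain ⟨h0, h1⟩ := hs n hn
    rw [Finset.mem_Icc]
    refine ⟨Nat.one_le_iff_ne_zero.mpr (Int.natAbs_ne_zero.mpr h0), Nat.le_floor ?_⟩
    rwa [Nat.cast_natAbs, Int.cast_abs]) (fun _ => zero_le_one)
  simp only [Finset.sum_const, nsmul_eq_mul, mul_one, Nat.card_Icc, Nat.add_sub_cancel] at h
  have := Nat.floor_le hy
  linarith

theorem sum_high_le {s : Finset ℤ} {y : ℝ} (hy : 0 < y) (hs : ∀ n ∈ s, y < |(n : ℝ)|) :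
    ∑ n ∈ s, ((n : ℝ) ^ 2)⁻¹ ≤ 4 / y := by
  have h := sum_natAbs_le (s := s) (A := Finset.Ioo ⌊y⌋₊ (s.sup Int.natAbs + 1))
    (g := fun i => ((i : ℝ) ^ 2)⁻¹) (fun n hn => by
      rw [Finset.mem_Ioo]
      refine ⟨(Nat.floor_lt hy.le).mpr ?_, Nat.lt_succ_of_le (Finset.le_sup (f := Int.natAbs) hn)⟩
      rw [Nat.cast_natAbs, Int.cast_abs]
      exact hs n hn) (fun _ => by positivity)
  have h1 : ∑ n ∈ s, ((n : ℝ) ^ 2)⁻¹ = ∑ n ∈ s, ((n.natAbs : ℝ) ^ 2)⁻¹ :=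
    Finset.sum_congr rfl fun n _ => by rw [Nat.cast_natAbs, Int.cast_abs, sq_abs]
  have h2 := sum_Ioo_inv_sq_le (α := ℝ) ⌊y⌋₊ (s.sup Int.natAbs + 1)
  have h3 : (2 : ℝ) / (⌊y⌋₊ + 1) ≤ 2 / y :=
    div_le_div_of_nonneg_left zero_le_two hy (Nat.lt_floor_add_one y).le
  rw [h1]
  calc _ ≤ _ := h
    _ ≤ 2 * (2 / y) := mul_le_mul_of_nonneg_left (h2.trans h3) zero_le_two
    _ = 4 / y := by ring

/-- Up to the contributions of low and high frequencies, the structure function at the scale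
`k⁻¹` is controlled by the Fourier coefficients in the layer of wave numbers comparable to `k`. -/
theorem structureFunction_le_layer {g g' : ℝ → ℝ} {m M k : ℝ} (hg : Function.Periodic g 1)
    (h : ∀ x, HasDerivAt g (g' x) x) (hc : Continuous g') (hm0 : 0 ≤ m)
    (hm : ∀ x, g' x ≤ m) (hM : 0 < M) (hk : 0 < k) :
    structureFunction g k⁻¹ ≤ 4 * ∑ n ∈ layer M k, ‖fourierCoefficient g n‖ ^ 2 +
      (8 * Real.pi ^ 2 + 16) * m ^ 2 * k⁻¹ / M := by
  classical
  have hgc : Continuous g := continuous_iff_continuousAt.mpr fun x => (h x).continuousAt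
  -- Bounding every finite partial sum avoids any discussion of infinite tails.
  refine hasSum_le_of_sum_le (hasSum_structureFunction hg hgc k⁻¹) fun s => ?_
  set c : ℤ → ℝ := fun n => ‖fourierCoefficient g n‖ with hcdef
  set e : ℤ → ℝ := fun n => ‖Complex.exp (2 * Real.pi * Complex.I * n * (k⁻¹ : ℝ)) - 1‖ with he
  have hcn : ∀ n, c n * |(n : ℝ)| ≤ m := norm_fourierCoefficient_le hg h hc hm0 hm
  have hc0 : ∀ n, 0 ≤ c n := fun n => norm_nonneg _
  have he0 : ∀ n, 0 ≤ e n := fun n => norm_nonneg _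
  have he2 : ∀ n, e n ≤ 2 := fun n => norm_exp_sub_one_le_two n _
  have hel : ∀ n, e n ≤ 2 * Real.pi * k⁻¹ * |(n : ℝ)| := fun n =>
    norm_exp_sub_one_le n (inv_pos.mpr hk).le
  have hlow : ∀ n, e n ^ 2 * c n ^ 2 ≤ 4 * Real.pi ^ 2 * m ^ 2 * (k⁻¹) ^ 2 := fun n => by
    have h1 : e n * c n ≤ 2 * Real.pi * k⁻¹ * m := by
      calc e n * c n ≤ 2 * Real.pi * k⁻¹ * |(n : ℝ)| * c n :=
            mul_le_mul_of_nonneg_right (hel n) (hc0 n)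
        _ = 2 * Real.pi * k⁻¹ * (c n * |(n : ℝ)|) := by ring
        _ ≤ 2 * Real.pi * k⁻¹ * m := mul_le_mul_of_nonneg_left (hcn n) (by positivity)
    have := pow_le_pow_left₀ (mul_nonneg (he0 n) (hc0 n)) h1 2
    linarith [this]
  have hhigh : ∀ n : ℤ, n ≠ 0 → e n ^ 2 * c n ^ 2 ≤ 4 * m ^ 2 * ((n : ℝ) ^ 2)⁻¹ := fun n hn => by
    have hn' : 0 < |(n : ℝ)| := abs_pos.mpr (Int.cast_ne_zero.mpr hn)
    have h1 : c n ≤ m * |(n : ℝ)|⁻¹ := by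
      rw [← div_eq_mul_inv, le_div_iff₀ hn']
      exact hcn n
    have h2 := mul_le_mul (pow_le_pow_left₀ (he0 n) (he2 n) 2) (pow_le_pow_left₀ (hc0 n) h1 2)
      (sq_nonneg _) (by norm_num)
    rw [mul_pow, inv_pow, sq_abs] at h2
    linarith
  have hmid : ∀ n, e n ^ 2 * c n ^ 2 ≤ 4 * c n ^ 2 := fun n => by
    have := pow_le_pow_left₀ (he0 n) (he2 n) 2
    exact mul_le_mul_of_nonneg_right (by linarith) (sq_nonneg _)
  -- The zero mode drops out, so the low modes may be counted without it.
  have hez : e 0 = 0 := by simp [he]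
  set s₁ := s.filter fun n : ℤ => n ≠ 0 ∧ |(n : ℝ)| < M⁻¹ * k with hs₁
  set s₂ := s.filter fun n : ℤ => M * k < |(n : ℝ)| with hs₂
  have hpt : ∀ n ∈ s, e n ^ 2 * c n ^ 2 ≤ (if n ∈ layer M k then 4 * c n ^ 2 else 0) +
      (if n ≠ 0 ∧ |(n : ℝ)| < M⁻¹ * k then 4 * Real.pi ^ 2 * m ^ 2 * (k⁻¹) ^ 2 else 0) +
      (if M * k < |(n : ℝ)| then 4 * m ^ 2 * ((n : ℝ) ^ 2)⁻¹ else 0) := fun n _ => by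
    have p1 : 0 ≤ (if n ∈ layer M k then 4 * c n ^ 2 else 0) := by split_ifs <;> positivity
    have p2 : 0 ≤ (if n ≠ 0 ∧ |(n : ℝ)| < M⁻¹ * k then 4 * Real.pi ^ 2 * m ^ 2 * (k⁻¹) ^ 2
        else 0) := by split_ifs <;> positivity
    have p3 : 0 ≤ (if M * k < |(n : ℝ)| then 4 * m ^ 2 * ((n : ℝ) ^ 2)⁻¹ else 0) := by
      split_ifs <;> positivity
    rcases eq_or_ne n 0 with rfl | hn
    · rw [hez]
      linarith [p1, p2, p3]
    by_cases hnl : n ∈ layer M k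
    · rw [if_pos hnl]
      linarith [hmid n]
    · rw [mem_layer, Set.mem_Icc, not_and_or, not_le, not_le] at hnl
      rcases hnl with hnl | hnl
      · rw [if_pos (⟨hn, hnl⟩ : n ≠ 0 ∧ |(n : ℝ)| < M⁻¹ * k)] at p2 ⊢
        linarith [hlow n]
      · rw [if_pos hnl] at p3 ⊢
        linarith [hhigh n hn]
  have hA : ∑ n ∈ s, (if n ∈ layer M k then 4 * c n ^ 2 else 0) ≤
      4 * ∑ n ∈ layer M k, c n ^ 2 := by
    rw [← Finset.sum_filter, Finset.mul_sum]
    exact Finset.sum_le_sum_of_subset_of_nonneg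
      (fun n hn => (Finset.mem_filter.mp hn).2) fun n _ _ => by positivity
  have hB : ∑ n ∈ s, (if n ≠ 0 ∧ |(n : ℝ)| < M⁻¹ * k then 4 * Real.pi ^ 2 * m ^ 2 * (k⁻¹) ^ 2
      else 0) ≤ 8 * Real.pi ^ 2 * m ^ 2 * k⁻¹ / M := by
    rw [← Finset.sum_filter, Finset.sum_const, nsmul_eq_mul]
    have := card_low_le (s := s₁) (y := M⁻¹ * k) (by positivity) fun n hn =>
      ⟨(Finset.mem_filter.mp hn).2.1, (Finset.mem_filter.mp hn).2.2.le⟩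
    calc _ ≤ 2 * (M⁻¹ * k) * (4 * Real.pi ^ 2 * m ^ 2 * (k⁻¹) ^ 2) :=
          mul_le_mul_of_nonneg_right this (by positivity)
      _ = _ := by field_simp; ring
  have hC : ∑ n ∈ s, (if M * k < |(n : ℝ)| then 4 * m ^ 2 * ((n : ℝ) ^ 2)⁻¹ else 0) ≤
      16 * m ^ 2 * k⁻¹ / M := by
    rw [← Finset.sum_filter, ← Finset.mul_sum]
    have := sum_high_le (s := s₂) (y := M * k) (by positivity) fun n hn =>
      (Finset.mem_filter.mp hn).2
    calc _ ≤ 4 * m ^ 2 * (4 / (M * k)) := mul_le_mul_of_nonneg_left this (by positivity)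
      _ = _ := by field_simp; ring
  have hsum := Finset.sum_le_sum hpt
  rw [Finset.sum_add_distrib, Finset.sum_add_distrib] at hsum
  calc _ ≤ _ := hsum
    _ ≤ 4 * ∑ n ∈ layer M k, c n ^ 2 + 8 * Real.pi ^ 2 * m ^ 2 * k⁻¹ / M +
        16 * m ^ 2 * k⁻¹ / M := by linarith
    _ = _ := by ring

theorem card_layer_le {M k : ℝ} (hMk : 1 ≤ M * k) :
    ∑ _n ∈ layer M k, (1 : ℝ) ≤ 3 * (M * k) := by
  have h1 : (layer M k).card ≤ (Finset.Icc (-⌊M * k⌋) ⌊M * k⌋).card :=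
    Finset.card_le_card (Finset.filter_subset _ _)
  rw [Int.card_Icc] at h1
  have h0 : 1 ≤ ⌊M * k⌋ := Int.le_floor.mpr (by exact_mod_cast hMk)
  have h2 : ((layer M k).card : ℤ) ≤ 3 * ⌊M * k⌋ := by omega
  have h3 : ((layer M k).card : ℝ) ≤ 3 * (⌊M * k⌋ : ℝ) := by exact_mod_cast h2
  rw [Finset.sum_const, nsmul_eq_mul, mul_one]
  linarith [Int.floor_le (M * k)]

/-! ### The energy spectrum -/

namespace IsFlow

variable {f : ℝ → ℝ} {ν : ℝ} {u v w z : ℝ → ℝ → ℝ}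

theorem continuous_sq_norm_fourierCoefficient (H : IsFlow f ν u v w z) (n : ℤ) :
    Continuous fun t => ‖fourierCoefficient (u t) n‖ ^ 2 := by
  have hu := H.continuous_u
  simp only [fourierCoefficient_eq]
  refine (Continuous.norm ?_).pow 2
  exact continuous_intervalIntegral (F := fun t (x : ℝ) =>
    Complex.exp (-(2 * Real.pi * Complex.I * n * x)) * (u t x : ℂ)) (by fun_prop) 0 1

theorem energySpectrum_le (H : IsFlow f ν u v w z) {D : ℝ} (hD : 0 ≤ D)
    (hv : ∀ t, 0 ≤ t → ∀ x, v t x ≤ D) {a b M k : ℝ} (ha : 0 ≤ a) (hab : a < b)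
    (hM : 0 < M) (hk : 0 < k) : energySpectrum a b M u k ≤ D ^ 2 * M ^ 2 * (k ^ 2)⁻¹ := by
  set A := D ^ 2 * M ^ 2 * (k ^ 2)⁻¹ with hA
  have hA0 : 0 ≤ A := by positivity
  have hcoeff : ∀ t, 0 ≤ t → ∀ n ∈ layer M k, ‖fourierCoefficient (u t) n‖ ^ 2 ≤ A :=
    fun t ht n hn => by
      have h1 := norm_fourierCoefficient_le (H.periodic t) (H.hasDerivAt_u t)
        (continuous_slice H.continuous_v t) hD (hv t ht) n
      have h2 := (mem_layer.mp hn).1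
      have h3 : ‖fourierCoefficient (u t) n‖ * (M⁻¹ * k) ≤ D :=
        (mul_le_mul_of_nonneg_left h2 (norm_nonneg _)).trans h1
      have h4 : ‖fourierCoefficient (u t) n‖ ≤ D * M * k⁻¹ := by
        rw [← le_div_iff₀ (by positivity)] at h3
        refine h3.trans_eq ?_
        field_simp
      calc _ ≤ (D * M * k⁻¹) ^ 2 := pow_le_pow_left₀ (norm_nonneg _) h4 2
        _ = A := by rw [hA]; ring
  have hint : ∀ t ∈ Icc a b, (∑ n ∈ layer M k, ‖fourierCoefficient (u t) n‖ ^ 2) /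
      (∑ _n ∈ layer M k, (1 : ℝ)) ≤ A := fun t ht => by
    refine div_le_of_le_mul₀ (Finset.sum_nonneg fun _ _ => zero_le_one) hA0 ?_
    rw [Finset.mul_sum]
    exact Finset.sum_le_sum fun n hn => (hcoeff t (ha.trans ht.1) n hn).trans_eq (mul_one A).symm
  have hcont : Continuous fun t => (∑ n ∈ layer M k, ‖fourierCoefficient (u t) n‖ ^ 2) /
      (∑ _n ∈ layer M k, (1 : ℝ)) :=
    (continuous_finsetSum _ fun n _ => H.continuous_sq_norm_fourierCoefficient n).div_const _
  have h1 := integral_mono_on hab.le (hcont.intervalIntegrable a b)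
    (intervalIntegrable_const (μ := volume) (c := A)) hint
  rw [intervalIntegral.integral_const, smul_eq_mul] at h1
  rw [energySpectrum, timeAverage, inv_mul_le_iff₀ (sub_pos.mpr hab)]
  exact h1

theorem le_energySpectrum (H : IsFlow f ν u v w z) {D : ℝ} (hD : 0 ≤ D)
    (hv : ∀ t, 0 ≤ t → ∀ x, v t x ≤ D) {a b M k c : ℝ} (ha : 0 ≤ a) (hab : a < b)
    (hM : 1 ≤ M) (hk : 1 ≤ k)
    (hS : c * k⁻¹ ≤ ∫ t in a..b, structureFunction (u t) k⁻¹)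
    (hMc : 2 * (b - a) * ((8 * Real.pi ^ 2 + 16) * D ^ 2) ≤ c * M) :
    c / (24 * M * (b - a)) * (k ^ 2)⁻¹ ≤ energySpectrum a b M u k := by
  have hM0 : 0 < M := by linarith
  have hk0 : 0 < k := by linarith
  have hMk : 1 ≤ M * k := one_le_mul_of_one_le_of_one_le hM hk
  have hba : 0 < b - a := sub_pos.mpr hab
  set B := (8 * Real.pi ^ 2 + 16) * D ^ 2 with hB
  set e : ℝ → ℝ := fun t => ∑ n ∈ layer M k, ‖fourierCoefficient (u t) n‖ ^ 2 with he
  set N : ℝ := ∑ _n ∈ layer M k, (1 : ℝ) with hN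
  have hec : Continuous e := continuous_finsetSum _ fun n _ =>
    H.continuous_sq_norm_fourierCoefficient n
  have he0 : ∀ t, 0 ≤ e t := fun t => Finset.sum_nonneg fun _ _ => sq_nonneg _
  have h1 : ∫ t in a..b, structureFunction (u t) k⁻¹ ≤ ∫ t in a..b, (4 * e t + B * k⁻¹ / M) :=
    integral_mono_on hab.le ((H.continuous_structureFunction _).intervalIntegrable _ _)
      (Continuous.intervalIntegrable (by fun_prop) _ _) fun t ht =>
        structureFunction_le_layer (H.periodic t) (H.hasDerivAt_u t)
          (continuous_slice H.continuous_v t) hD (hv t (ha.trans ht.1)) hM0 hk0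
  rw [intervalIntegral.integral_add (Continuous.intervalIntegrable (by fun_prop) _ _)
    (intervalIntegrable_const), intervalIntegral.integral_const_mul,
    intervalIntegral.integral_const, smul_eq_mul] at h1
  have h2 : (b - a) * (B * k⁻¹ / M) ≤ c * k⁻¹ / 2 := by
    have : (b - a) * B / M ≤ c / 2 := by
      rw [div_le_iff₀ hM0]
      linarith
    calc (b - a) * (B * k⁻¹ / M) = (b - a) * B / M * k⁻¹ := by ring
      _ ≤ c / 2 * k⁻¹ := mul_le_mul_of_nonneg_right this (by positivity)
      _ = _ := by ring
  have h3 : c * k⁻¹ / 8 ≤ ∫ t in a..b, e t := by linarith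
  have h4 : ∫ t in a..b, e t / (3 * (M * k)) ≤ ∫ t in a..b, e t / N := by
    refine integral_mono_on hab.le ((hec.div_const _).intervalIntegrable _ _)
      ((hec.div_const _).intervalIntegrable _ _) fun t _ => ?_
    -- For an empty layer both quotients are 0, division by zero included.
    rcases (layer M k).eq_empty_or_nonempty with hemp | hne
    · simp [he, hemp]
    · have hNpos : 0 < N := Finset.sum_pos (fun _ _ => one_pos) hne
      exact div_le_div_of_nonneg_left (he0 t) hNpos (card_layer_le hMk)
  rw [intervalIntegral.integral_div] at h4
  have h5 : c * k⁻¹ / 8 / (3 * (M * k)) ≤ (∫ t in a..b, e t) / (3 * (M * k)) :=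
    div_le_div_of_nonneg_right h3 (by positivity)
  rw [energySpectrum, timeAverage]
  calc _ = (b - a)⁻¹ * (c * k⁻¹ / 8 / (3 * (M * k))) := by field_simp; ring
    _ ≤ _ := mul_le_mul_of_nonneg_left (h5.trans h4) (inv_pos.mpr hba).le

end IsFlow

/-! ### Range conditions and choice of constants -/

theorem AdmissibleRanges.lt_one {K C₁ C₂ ν₀ : ℝ} (h : AdmissibleRanges K C₁ C₂ ν₀) (hK : 1 ≤ K) :
    ν₀ < 1 := by
  have h1 := h.le_ratio.trans_lt h.ratio_lt
  have h2 : 1 < 1 / ν₀ := by nlinarith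
  rwa [lt_div_iff₀ h.ν₀_pos, one_mul] at h2

theorem AdmissibleRanges.C₂_mul_le {K C₁ C₂ ν₀ : ℝ} (h : AdmissibleRanges K C₁ C₂ ν₀)
    (hK : 1 ≤ K) : C₂ * K ^ 4 ≤ 1 / 20 := by
  have hK2 : 0 < K ^ 2 := by positivity
  have h1 := h.le_ratio
  rw [le_div_iff₀ h.C₂_pos] at h1
  have h2 := h1.trans h.C₁_le
  have h3 := mul_le_mul_of_nonneg_right h2 hK2.le
  rw [mul_assoc (1 / 4), inv_mul_cancel₀ hK2.ne'] at h3
  nlinarith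

end Burgulence

theorem theorem4p3 (f : ℝ → ℝ) (hf : ContDiff ℝ ∞ f) (σ : ℝ) (hσ : 0 < σ)
    (hconv : ∀ x, σ ≤ deriv (deriv f) x) (D : ℝ) (hD : 0 < D) :
    (∃ Ct : ℝ, 0 < Ct ∧ Burgulence.IsH1Bound f D Ct) ∧
    ∀ Ct : ℝ, 0 < Ct → Burgulence.IsH1Bound f D Ct →
      ∃ K₁ : ℝ, 1 < K₁ ∧ ∀ K, K₁ ≤ K →
        ∀ C₁ C₂ ν₀ : ℝ, Burgulence.AdmissibleRanges K C₁ C₂ ν₀ →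
          ∃ M₀ : ℝ, 1 ≤ M₀ ∧ ∀ M, M₀ ≤ M →
            ∃ C : ℝ, 0 < C ∧
              ∀ ν : ℝ, 0 < ν → ν ≤ ν₀ →
                ∀ u : ℝ → ℝ → ℝ, Burgulence.IsSolution f ν u →
                  Burgulence.genericity (u 0) = D →
                    ∀ k : ℝ, k⁻¹ ∈ Burgulence.inertialRange C₁ C₂ ν →
                      C⁻¹ * (k ^ 2)⁻¹ ≤
                          Burgulence.energySpectrum (Burgulence.T₁ D Ct)
                            (Burgulence.T₂ σ D Ct) M u k ∧
                        Burgulence.energySpectrum (Burgulence.T₁ D Ct)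
                            (Burgulence.T₂ σ D Ct) M u k ≤ C * (k ^ 2)⁻¹ := by
  have hconv0 : ∀ x, 0 ≤ deriv (deriv f) x := fun x => hσ.le.trans (hconv x)
  refine ⟨Burgulence.exists_isH1Bound hf hconv0 hD, fun Ct hCt hbound => ?_⟩
  -- The bound K ≥ D makes C₂ D⁴ ≤ 1/20, the smallness of l = 1/k needed in the flux estimate; the 2
  -- ensures K₁ > 1.
  refine ⟨max 2 D, lt_of_lt_of_le one_lt_two (le_max_left _ _), fun K hK C₁ C₂ ν₀ hadm => ?_⟩
  have hK2 : 2 ≤ K := (le_max_left _ _).trans hK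
  have hKD : D ≤ K := (le_max_right _ _).trans hK
  have hK1 : 1 ≤ K := one_le_two.trans hK2
  obtain ⟨Λ, hΛ0, hΛ⟩ := Burgulence.exists_lipschitz_bound hf D
  have hC₁ := hadm.C₁_pos
  have hC₂ := hadm.C₂_pos
  have hC₂K := hadm.C₂_mul_le hK1
  have hT1 : 0 < Burgulence.T₁ D Ct := by unfold Burgulence.T₁; positivity
  have hT : Burgulence.T₁ D Ct < Burgulence.T₂ σ D Ct :=
    lt_of_lt_of_le (by linarith) (le_max_left _ _)
  set a := Burgulence.T₁ D Ct with ha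
  set b := Burgulence.T₂ σ D Ct with hb
  have hba : 0 < b - a := sub_pos.mpr hT
  set ε := 1 / 4 * (D ^ 2)⁻¹ with hε
  have hε0 : 0 < ε := by positivity
  -- The growth constant for r = C₁: the lower end of the inertial range is exactly the condition rν
  -- ≤ l.
  set c := Real.exp (-(Λ * C₁)) * (ε * C₁ / 8) with hc
  have hc0 : 0 < c := by positivity
  set B := (8 * Real.pi ^ 2 + 16) * D ^ 2 with hB
  -- For such M, the modes outside the layer account for at most half of c/k.
  refine ⟨max 1 (2 * (b - a) * B / c), le_max_left _ _, fun M hM => ?_⟩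
  have hM1 : 1 ≤ M := (le_max_left _ _).trans hM
  have hM0 : 0 < M := by linarith
  have hMc : 2 * (b - a) * B ≤ c * M := by
    have := (le_max_right _ _).trans hM
    rwa [div_le_iff₀ hc0, mul_comm M c] at this
  refine ⟨max (D ^ 2 * M ^ 2) (24 * M * (b - a) / c), lt_max_of_lt_left (by positivity),
    fun ν hν hνν₀ u₁ hsol hgen k hk => ?_⟩
  have hν1 : ν ≤ 1 := hνν₀.trans (hadm.lt_one hK1).le
  obtain ⟨hk1, hk2⟩ := hk
  have hkinv : 0 < k⁻¹ := (mul_pos hC₁ hν).trans hk1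
  have hk0 : 0 < k := inv_pos.mp hkinv
  have hK4 : 1 ≤ K ^ 4 := one_le_pow₀ hK1
  have hkone : 1 ≤ k := by
    have : k⁻¹ ≤ 1 := by nlinarith
    exact (inv_le_one₀ hk0).mp this
  obtain ⟨v, w, z, H⟩ := hsol.exists_isFlow hf
  set u : ℝ → ℝ → ℝ := fun t => u₁ (max t 0) with hu
  have hu1 : ∀ t, 0 ≤ t → u t = u₁ t := fun t ht => by simp [hu, max_eq_left ht]
  have hgen' : Burgulence.genericity (u 0) = D := by rw [hu1 0 le_rfl, hgen]
  have hv : ∀ t, 0 ≤ t → ∀ x, v t x ≤ D := fun t ht x =>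
    H.v_le hν.le hconv0 (fun x => hgen' ▸ (abs_le.mp (H.abs_v_zero_le x)).2) ht x
  have hL1 : D⁻¹ ≤ Burgulence.normL1 (u 0) := by
    have := H.inv_genericity_le (hgen'.symm ▸ hD)
    rwa [hgen'] at this
  have hH1 : ∀ t, 0 ≤ t → Burgulence.sqNormH1 (u t) ≤ Ct * ν⁻¹ := fun t ht =>
    hu1 t ht ▸ hbound ν hν hν1 u₁ hsol hgen t ht
  have hdrop := H.energy_drop hf hν hσ hconv hD hCt hL1 hH1
  have hl : 4 * D ^ 2 * k⁻¹ ≤ ε := by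
    have hD4 : D ^ 4 ≤ K ^ 4 := pow_le_pow_left₀ hD.le hKD 4
    have h1 : k⁻¹ * D ^ 4 ≤ 1 / 20 := (mul_le_mul hk2 hD4 (by positivity) hC₂.le).trans hC₂K
    rw [hε, ← div_eq_mul_inv (1 / 4 : ℝ), le_div_iff₀ (by positivity)]
    calc 4 * D ^ 2 * k⁻¹ * D ^ 2 = 4 * (k⁻¹ * D ^ 4) := by ring
      _ ≤ 1 / 4 := by linarith
  have hS := H.le_integral_structureFunction hf hν hD.le hΛ0 hΛ hv hT1.le hT.le hε0.le hdrop
    hC₁.le hk1.le hl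
  have hspec : Burgulence.energySpectrum a b M u₁ k = Burgulence.energySpectrum a b M u k := by
    unfold Burgulence.energySpectrum Burgulence.timeAverage
    congr 1
    refine intervalIntegral.integral_congr fun t ht => ?_
    rw [Set.uIcc_of_le hT.le] at ht
    simp only [hu1 t (hT1.le.trans ht.1)]
  have hk2inv : 0 ≤ (k ^ 2)⁻¹ := by positivity
  rw [hspec]
  constructor
  · refine le_trans (mul_le_mul_of_nonneg_right ?_ hk2inv)
      (H.le_energySpectrum hD.le hv hT1.le hT hM1 hkone hS hMc)
    rw [← inv_div (24 * M * (b - a)) c]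
    exact inv_anti₀ (by positivity) (le_max_right _ _)
  · exact (H.energySpectrum_le hD.le hv hT1.le hT hM0 hk0).trans
      (mul_le_mul_of_nonneg_right (le_max_left _ _) hk2inv)
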